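/- Fix an integer $k\ge 0$. For an $n$ mode fermionic system with annihilation operators $a_1,\dots,a_n$, let $\gamma_{2j-1}=a_j^\dagger+a_j$, $\gamma_{2j}=i(a_j^\dagger-a_j)$ be the $2n$ Majorana operators, let $\gamma_S=i^{\binom{|S|}{2}}\gamma_{j_1}\cdots\gamma_{j_m}$ for $S=\{j_1<\dots<j_m\}\subseteq[2n]$, and let $\mathcal S_{2k}$ be the set of $2k$-element subsets of $[2n]$. Let $\mathcal D_{2k}\subseteq\mathcal S_{2k}$ be the set of unions of $k$ distinct pairs $R_j=\{2j-1,2j\}$. For a real $2n\times 2n$ matrix $O$ let $O_{R,S}$ be the submatrix with rows $R$ and columns $S$, both in ascending order. For orthogonal $O$ let $\mathsf G^{O}$ be the measurement with outcomes $\mathbf q\in\{\pm1\}^n$, $X\subseteq[2n]$ and effects $$\mathsf G^O(\mathbf q,X)=(2^{2n})^{n-1}\prod_{j=1}^n \frac{1}{2^{2n}}\,\gamma_X^\dagger\,\tfrac12\Bigl(1+q_j\sum_{S\in\mathcal S_2}\det(O_{R_j,S})\,\gamma_S\Bigr)\gamma_X .$$ Given orthogonal matrices $O^{(1)},\dots,O^{(N)}$,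 let $\mathsf G$ be the measurement that draws $r\in[N]$ uniformly at random and measures $\mathsf G^{O^{(r)}}$. For every $r$ and every $S\in\mathcal S_{2k}$ let $R=R(r,S)\in\mathcal D_{2k}$ maximize $|\det O^{(r)}_{R,S}|$, and put $\eta_S=\frac1N\sum_{r}|\det O^{(r)}_{R(r,S),S}|$. From an outcome $(r,\mathbf q,X)$ of $\mathsf G$ put $e_S=\operatorname{sgn}(\det O^{(r)}_{R,S})\,(-1)^{|X||S|-|S\cap X|}\prod_{j:R_j\subseteq R}q_j$ if the determinant is non-zero, and let $e_S=\pm1$ be a fair coin flip otherwise. The estimator $\hat\Gamma_S$ of $\operatorname{tr}(\gamma_S\rho)$ from $L$ independent runs of $\mathsf G$ on copies of $\rho$ is the mean of the $L$ values of $\eta_S^{-1}e_S$. Then there are $C>0$ and $n_0$, depending only on $k$, such that for all $n>n_0$ and all $N>4k$ there are orthogonal matrices $O^{(1)},\dots,O^{(N)}$ for which $\mathsf G$ is a POVM and the following holds for every choice of the maximizers $R(r,S)$. For all $\epsilon>0$, all $\delta\in(0,1)$, every number of samples $$L\ \ge\ C\cdot\frac{2n^{k}}{\epsilon^2}\log\left(\frac{2|\mathcal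 S_{2k}|}{\delta}\right)$$ and every state $\rho$, with probability at least $1-\delta$ we have $|\operatorname{tr}(\gamma_S\rho)-\hat\Gamma_S|<\epsilon$ simultaneously for all $S\in\mathcal S_{2k}$. That is, all degree-$2k$ Majorana expectation values are estimated simultaneously to additive error $\epsilon$ with probability at least $1-\delta$ with $L_{2k}=\mathcal O\bigl(\frac{2n^{k}}{\epsilon^2}\log(2|\mathcal S_{2k}|/\delta)\bigr)$ samples. -/

import Mathlib

open scoped ComplexOrder

namespace FermionicJM

noncomputable section

/-! ## Majorana operators of an `n` mode fermionic system -/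

/-- Operators on the Fock space of `n` fermionic modes, as matrices in the occupation number basis.
A basis vector is labelled by the set of occupied modes. -/
abbrev FockOp (n : ℕ) : Type := Matrix (Finset (Fin n)) (Finset (Fin n)) ℂ

/-- The annihilation operator `a_j`: it empties mode `j`, with the sign `(-1)` to the number of
occupied modes before `j`. -/
def annihilation {n : ℕ} (j : Fin n) : FockOp n := fun s t =>
  if j ∈ t ∧ s = t.erase j then (-1) ^ (t.filter (fun i => i < j)).card else 0

/-- The creation operator, the adjoint of the annihilation operator. -/
def creation {n : ℕ} (j : Fin n) : FockOp n := (annihilation j).conjTranspose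

/-- The mode to which a Majorana operator belongs. Majorana labels are `0, …, 2n - 1`, and mode `j`
carries the labels `2j` and `2j + 1`. -/
def modeOf {n : ℕ} (m : Fin (2 * n)) : Fin n := ⟨m.val / 2, by omega⟩

/-- The `2n` Majorana operators: `a† + a` for the first and `i (a† - a)` for the second of the two
labels of each mode. -/
def majorana {n : ℕ} (m : Fin (2 * n)) : FockOp n :=
  if m.val % 2 = 0 then creation (modeOf m) + annihilation (modeOf m)
  else Complex.I • (creation (modeOf m) - annihilation (modeOf m))

/-- The Majorana monomial `γ_S`, the product of the `γ_j`, `j ∈ S`, in ascending order, with the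
phase `i ^ (|S| choose 2)`. -/
def monomial {n : ℕ} (S : Finset (Fin (2 * n))) : FockOp n :=
  Complex.I ^ (S.card.choose 2) • ((S.sort (· ≤ ·)).map majorana).prod

/-- The `m`-element sets of Majorana labels. -/
abbrev Label (n m : ℕ) : Type := {S : Finset (Fin (2 * n)) // S.card = m}

/-- A density matrix on Fock space. -/
def IsState {n : ℕ} (ρ : FockOp n) : Prop := ρ.PosSemidef ∧ ρ.trace = 1

/-- The expectation value `tr (γ_S ρ)`. -/
def expectation {n : ℕ} (S : Finset (Fin (2 * n))) (ρ : FockOp n) : ℝ :=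
  ((monomial S * ρ).trace).re

/-! ## Labels of the commuting observables of the computational basis measurement -/

/-- All Majorana labels belonging to the modes in `T`. -/
def modeLabels {n : ℕ} (T : Finset (Fin n)) : Finset (Fin (2 * n)) :=
  Finset.univ.filter (fun m => modeOf m ∈ T)

theorem card_modeLabels {n : ℕ} (T : Finset (Fin n)) : (modeLabels T).card = 2 * T.card := by
  have h : (modeLabels T).card = (T ×ˢ (Finset.univ : Finset (Fin 2))).card := by
    refine Finset.card_bij (fun m _ => (modeOf m, ⟨m.val % 2, by omega⟩)) ?_ ?_ ?_
    · intro m hm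
      simpa [modeLabels] using hm
    · intro a _ b _ hab
      simp only [modeOf, Prod.mk.injEq, Fin.mk.injEq] at hab
      ext
      omega
    · rintro ⟨j, b⟩ hjb
      have hj : j ∈ T := by simpa using hjb
      have e : modeOf (⟨2 * j.val + b.val, by omega⟩ : Fin (2 * n)) = j := by
        ext
        simp only [modeOf]
        omega
      refine ⟨⟨2 * j.val + b.val, by omega⟩, ?_, ?_⟩
      · simpa [modeLabels, e] using hj
      · refine Prod.ext e ?_
        ext
        simp only
        omega
  rw [h, Finset.card_product, Finset.card_univ, Fintype.card_fin, mul_comm]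

/-- The `k`-element sets of modes. They parametrize the diagonal labels of degree `2k`, that is, the
unions of `k` distinct pairs `{2j, 2j + 1}`. -/
abbrev ModeSet (n k : ℕ) : Type := {T : Finset (Fin n) // T.card = k}

/-- The diagonal label of degree `2k` given by `k` modes. -/
def ModeSet.label {n k : ℕ} (T : ModeSet n k) : Label n (2 * k) :=
  ⟨modeLabels T.1, by rw [card_modeLabels, T.2]⟩

/-- A single mode as a one-element set of modes. -/
def singleMode {n : ℕ} (j : Fin n) : ModeSet n 1 := ⟨{j}, Finset.card_singleton j⟩

/-! ## The joint measurement -/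

/-- The minor `det (O_{R,S})` with rows `R` and columns `S`, both in ascending order. -/
def minor {n m : ℕ} (O : Matrix (Fin (2 * n)) (Fin (2 * n)) ℝ) (R S : Label n m) : ℝ :=
  (O.submatrix (R.1.orderEmbOfFin R.2) (S.1.orderEmbOfFin S.2)).det

/-- The rotated observable `γ_R^O = ∑_S det (O_{R,S}) γ_S`. -/
def rotated {n m : ℕ} (O : Matrix (Fin (2 * n)) (Fin (2 * n)) ℝ) (R : Label n m) : FockOp n :=
  ∑ S : Label n m, ((minor O R S : ℝ) : ℂ) • monomial S.1

/-- The POVM `G_R^O (q, X) = 2^(-2n) γ_X† (1 + q γ_R^O) / 2 γ_X` for the pair `R` of labels of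
mode `j`. -/
def pairEffect {n : ℕ} (O : Matrix (Fin (2 * n)) (Fin (2 * n)) ℝ) (j : Fin n) (q : ℤˣ)
    (X : Finset (Fin (2 * n))) : FockOp n :=
  ((2 : ℂ) ^ (2 * n))⁻¹ •
    ((monomial X).conjTranspose *
      ((1 / 2 : ℂ) • (1 + (((q : ℤ) : ℂ)) • rotated O (singleMode j).label)) * monomial X)

/-- The POVM `G^O (q, X) = (2^(2n))^(n-1) ∏_j G_{R_j}^O (q_j, X)`, where `R_j` is the pair of labels
of mode `j`. -/
def parent {n : ℕ} (O : Matrix (Fin (2 * n)) (Fin (2 * n)) ℝ) (q : Fin n → ℤˣ)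
    (X : Finset (Fin (2 * n))) : FockOp n :=
  ((2 : ℂ) ^ (2 * n)) ^ (n - 1) • (List.ofFn (fun j => pairEffect O j (q j) X)).prod

/-- Outcomes `(r, q, X)` of the randomized joint measurement. -/
abbrev Outcome (n N : ℕ) : Type := Fin N × (Fin n → ℤˣ) × Finset (Fin (2 * n))

/-- The uniform randomization over the `N` measurements given by `O 0, …, O (N - 1)`. -/
def jointMeasurement {n N : ℕ} (O : Fin N → Matrix (Fin (2 * n)) (Fin (2 * n)) ℝ)
    (ω : Outcome n N) : FockOp n :=
  (N : ℂ)⁻¹ • parent (O ω.1) ω.2.1 ω.2.2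

/-- A POVM with finite outcome set. -/
def IsPOVM {n : ℕ} {Ω : Type} [Fintype Ω] (M : Ω → FockOp n) : Prop :=
  (∀ ω, (M ω).PosSemidef) ∧ ∑ ω, M ω = 1

/-! ## Post-processing and estimation -/

/-- `R r S` is a choice, for every measurement `r` and every `S`, of a diagonal label for which the
sharpness `|det (O_{R,S})|` is maximal. -/
def IsOptimalChoice {n N k : ℕ} (O : Fin N → Matrix (Fin (2 * n)) (Fin (2 * n)) ℝ)
    (R : Fin N → Label n (2 * k) → ModeSet n k) : Prop :=
  ∀ r S, ∀ T : ModeSet n k, |minor (O r) T.label S| ≤ |minor (O r) (R r S).label S|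

/-- The sharpness `η_S` of the observable `γ_S` obtained from the randomized joint measurement, the
average of the sharpnesses of the `N` measurements. -/
def sharpness {n N k : ℕ} (O : Fin N → Matrix (Fin (2 * n)) (Fin (2 * n)) ℝ)
    (R : Fin N → Label n (2 * k) → ModeSet n k) (S : Label n (2 * k)) : ℝ :=
  (N : ℝ)⁻¹ * ∑ r, |minor (O r) (R r S).label S|

/-- The sign `x_S = (-1)^(|X| |S| - |S ∩ X|)`. -/
def xSign {n : ℕ} (X S : Finset (Fin (2 * n))) : ℝ :=
  (-1) ^ (X.card * S.card - (S ∩ X).card)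

/-- The data of one shot: an outcome of the joint measurement and one coin for every `S`. The coin
is used if the sampled measurement carries no information about `γ_S`. -/
abbrev Shot (n N k : ℕ) : Type := Outcome n N × (Label n (2 * k) → ℤˣ)

/-- The probability of a shot on the state `ρ`; the coins are fair and independent. -/
def shotProb {n N : ℕ} (k : ℕ) (O : Fin N → Matrix (Fin (2 * n)) (Fin (2 * n)) ℝ) (ρ : FockOp n)
    (ω : Shot n N k) : ℝ :=
  ((jointMeasurement O ω.1 * ρ).trace).re * ((2 : ℝ) ^ Fintype.card (Label n (2 * k)))⁻¹

/-- The outcome `e_S = ±1` of the unsharp observable: `sgn (det (O_{R,S})) x_S q_R`, where `q_R` is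
the product of the `q_j` over the modes of `R`, or a coin flip if the determinant vanishes. -/
def outcomeSign {n N k : ℕ} (O : Fin N → Matrix (Fin (2 * n)) (Fin (2 * n)) ℝ)
    (R : Fin N → Label n (2 * k) → ModeSet n k) (S : Label n (2 * k)) (ω : Shot n N k) : ℝ :=
  if minor (O ω.1.1) (R ω.1.1 S).label S = 0 then (((ω.2 S : ℤˣ) : ℤ) : ℝ)
  else Real.sign (minor (O ω.1.1) (R ω.1.1 S).label S) * xSign ω.1.2.2 S.1 *
    ∏ j ∈ (R ω.1.1 S).1, (((ω.1.2.1 j : ℤˣ) : ℤ) : ℝ)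

/-- The estimator of `tr (γ_S ρ)` from `L` shots: the mean of the single shot estimators
`η_S⁻¹ e_S`. -/
def estimator {n N k L : ℕ} (O : Fin N → Matrix (Fin (2 * n)) (Fin (2 * n)) ℝ)
    (R : Fin N → Label n (2 * k) → ModeSet n k) (S : Label n (2 * k))
    (ω : Fin L → Shot n N k) : ℝ :=
  (L : ℝ)⁻¹ * ∑ j, (sharpness O R S)⁻¹ * outcomeSign O R S (ω j)

open Classical in
/-- The probability of an event for `L` independent samples with common probability mass function
`p` on a finite set. -/
def iidProb {Ω : Type} [Fintype Ω] (p : Ω → ℝ) (L : ℕ) (E : Set (Fin L → Ω)) : ℝ :=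
  ∑ ω : Fin L → Ω, if ω ∈ E then ∏ j, p (ω j) else 0

end

end FermionicJM

namespace FermionicJM

/-! Two independent facts combine. The first is that each single-shot estimator is unbiased and
bounded by `η_S⁻¹`. For orthogonal `O` the operators `∑_a O_{u,a} γ_a` again satisfy the canonical
anticommutation relations, so the pair observables `γ_{R_j}^O` are commuting self-adjoint
involutions and `G^O` is a uniform mixture over `X` of their joint spectral measurement conjugated
by `γ_X`. Conjugation multiplies a word of even length by a sign character of `X`. Averaging against
`x_S` therefore kills every word except the orderings of `S`, and sorting these produces the Leibniz
expansion of `det O_{R,S}` (`sum_xSign_parent`). An exponential moment bound and a union bound over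
`S` (`iidProb_forall_abs_sum_lt`) then show that `L` of order `η⁻² ε⁻² log(2|𝒮|/δ)` suffices, where
`η` is a lower bound for all `η_S`.

The second fact is that one can achieve `η_S ≥ c n^(-k/2)` for all `S` simultaneously. Take a block
diagonal matrix of about `√n` flat Hadamard blocks of size `m ~ √n`, with entries `±m^(-1/2)`, and
arrange its rows so that any two blocks are linked by a mode having one row in each
(`exists_block_matrix`). If the `2k` columns `S` lie in distinct blocks, pair these blocks up and
take the linking modes: up to row order the submatrix is diagonal, with determinant `±m^(-k)`
(`exists_large_minor`). A random column permutation fails to separate `S` in this way with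
probability `O(n^(-1/2))`, while there are `O(n^(2k))` sets `S`. For large `n` some `4k + 1`
permutations thus serve every `S` (`exists_orthogonal_family`). Cycling through them over `r` costs
only a factor depending on `k`, which is where `N > 4k` enters (`le_sharpness`). -/

/-! ## Majorana operators as signed permutation matrices -/

/-- The parity of the number of elements of `t` below `j`, as a sign. -/
noncomputable def belowSign {n : ℕ} (j : Fin n) (t : Finset (Fin n)) : ℂ :=
  ∏ i ∈ t, if i < j then -1 else 1

/-- The occupation of mode `j` as a sign. -/
noncomputable def occSign {n : ℕ} (j : Fin n) (t : Finset (Fin n)) : ℂ := if j ∈ t then -1 else 1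

theorem belowSign_eq {n : ℕ} (j : Fin n) (t : Finset (Fin n)) :
    belowSign j t = (-1) ^ (t.filter (fun i => i < j)).card := by
  rw [belowSign, Finset.prod_ite]
  simp

theorem prod_symmDiff_singleton {n : ℕ} (f : Fin n → ℂ) (hf : ∀ i, f i * f i = 1) (j : Fin n)
    (t : Finset (Fin n)) : ∏ i ∈ symmDiff t {j}, f i = f j * ∏ i ∈ t, f i := by
  by_cases h : j ∈ t
  · have : symmDiff t {j} = t.erase j := by
      ext i; simp only [Finset.mem_symmDiff, Finset.mem_singleton, Finset.mem_erase]
      constructor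
      · rintro (h | h); exacts [⟨h.2, h.1⟩, absurd (h.1 ▸ ‹j ∈ t›) h.2]
      · tauto
    rw [this, ← Finset.mul_prod_erase t f h, ← mul_assoc, hf, one_mul]
  · have : symmDiff t {j} = insert j t := by
      ext i; simp only [Finset.mem_symmDiff, Finset.mem_singleton, Finset.mem_insert]
      constructor
      · tauto
      · rintro (h | h)
        · subst h; exact Or.inr ⟨rfl, ‹_›⟩
        · exact Or.inl ⟨h, fun e => ‹j ∉ t› (e ▸ h)⟩
    rw [this, Finset.prod_insert h]

theorem belowSign_symmDiff {n : ℕ} (j i : Fin n) (t : Finset (Fin n)) :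
    belowSign j (symmDiff t {i}) = (if i < j then -1 else 1) * belowSign j t :=
  prod_symmDiff_singleton _ (fun i => by split_ifs <;> simp) i t

theorem occSign_symmDiff {n : ℕ} (j i : Fin n) (t : Finset (Fin n)) :
    occSign j (symmDiff t {i}) = (if j = i then -1 else 1) * occSign j t := by
  unfold occSign
  by_cases h : j ∈ t <;> by_cases h' : j = i <;> simp [Finset.mem_symmDiff, h, h']

theorem belowSign_mul_self {n : ℕ} (j : Fin n) (t : Finset (Fin n)) :
    belowSign j t * belowSign j t = 1 := by
  rw [belowSign_eq, ← mul_pow]; simp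

theorem occSign_mul_self {n : ℕ} (j : Fin n) (t : Finset (Fin n)) :
    occSign j t * occSign j t = 1 := by
  unfold occSign; split_ifs <;> simp

/-- The phase acquired by the basis vector `t` under a Majorana operator. -/
noncomputable def majoranaPhase {n : ℕ} (m : Fin (2 * n)) (t : Finset (Fin n)) : ℂ :=
  if m.val % 2 = 0 then belowSign (modeOf m) t
  else Complex.I * (belowSign (modeOf m) t * occSign (modeOf m) t)

/-- Creation and annihilation act on complementary sets of basis vectors, so their sum and
difference are signed permutation matrices flipping one mode. Products can then be compared entry by
entry. -/
theorem majorana_apply {n : ℕ} (m : Fin (2 * n)) (s t : Finset (Fin n)) :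
    majorana m s t = if s = symmDiff t {modeOf m} then majoranaPhase m t else 0 := by
  have hc : creation (modeOf m) s t =
      if s = symmDiff t {modeOf m} ∧ modeOf m ∉ t then belowSign (modeOf m) t else 0 := by
    set j := modeOf m
    simp only [creation, Matrix.conjTranspose_apply, annihilation, belowSign_eq]
    by_cases h : j ∈ t
    · have : ¬ (j ∈ s ∧ t = s.erase j) := by rintro ⟨_, e⟩; rw [e] at h; simp at h
      simp [this, h]
    · have e : symmDiff t {j} = insert j t := by
        ext i; simp only [Finset.mem_symmDiff, Finset.mem_singleton, Finset.mem_insert]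
        constructor
        · tauto
        · rintro (h' | h')
          · subst h'; exact Or.inr ⟨rfl, h⟩
          · exact Or.inl ⟨h', fun e => h (e ▸ h')⟩
      have iff : (j ∈ s ∧ t = s.erase j) ↔ s = insert j t := by
        constructor
        · rintro ⟨h1, h2⟩; rw [h2, Finset.insert_erase h1]
        · rintro rfl; simp [h]
      simp only [iff, e, h, not_false_eq_true, and_true]
      split_ifs with hs
      · subst hs
        simp [Finset.filter_insert]
      · simp
  have ha : annihilation (modeOf m) s t =
      if s = symmDiff t {modeOf m} ∧ modeOf m ∈ t then belowSign (modeOf m) t else 0 := by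
    set j := modeOf m
    simp only [annihilation, belowSign_eq]
    by_cases h : j ∈ t
    · have e : symmDiff t {j} = t.erase j := by
        ext i; simp only [Finset.mem_symmDiff, Finset.mem_singleton, Finset.mem_erase]
        constructor
        · rintro (h' | h'); exacts [⟨h'.2, h'.1⟩, absurd (h'.1 ▸ h) h'.2]
        · tauto
      simp [h, e]
    · simp [h]
  unfold majorana majoranaPhase
  split_ifs <;>
  simp_all [Matrix.add_apply, Matrix.smul_apply, Matrix.sub_apply, occSign] <;>
  split_ifs <;> simp_all

theorem majorana_mul_apply {n : ℕ} (a b : Fin (2 * n)) (s t : Finset (Fin n)) :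
    (majorana a * majorana b) s t =
      if s = symmDiff (symmDiff t {modeOf b}) {modeOf a} then
        majoranaPhase a (symmDiff t {modeOf b}) * majoranaPhase b t else 0 := by
  rw [Matrix.mul_apply, Finset.sum_eq_single (symmDiff t {modeOf b})]
  · simp [majorana_apply]
  · intro u _ hu
    simp [majorana_apply, hu]
  · simp

theorem majorana_mul_self {n : ℕ} (a : Fin (2 * n)) : majorana a * majorana a = 1 := by
  ext s t
  rw [majorana_mul_apply, symmDiff_assoc, symmDiff_self, symmDiff_bot, Matrix.one_apply]
  have h1 := belowSign_mul_self (modeOf a) t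
  have h2 := occSign_mul_self (modeOf a) t
  split_ifs with h
  · unfold majoranaPhase
    split_ifs
    · simp [belowSign_symmDiff, h1]
    · simp only [belowSign_symmDiff, occSign_symmDiff, lt_irrefl, if_false, if_true]
      linear_combination (-Complex.I * Complex.I * occSign (modeOf a) t * occSign (modeOf a) t) * h1
        - Complex.I * Complex.I * h2 - Complex.I_mul_I
  · rfl

theorem majorana_anticomm {n : ℕ} {a b : Fin (2 * n)} (hab : a ≠ b) :
    majorana a * majorana b = - (majorana b * majorana a) := by
  ext s t
  rw [Matrix.neg_apply, majorana_mul_apply, majorana_mul_apply, symmDiff_right_comm]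
  split_ifs with h
  · unfold majoranaPhase
    have hne : modeOf a = modeOf b → a.val % 2 ≠ b.val % 2 := by
      intro h1 h2
      simp only [modeOf, Fin.mk.injEq] at h1
      exact hab (Fin.ext (by omega))
    -- For different modes the sign comes from `belowSign` of the larger mode, which sees the flip
    -- of the smaller one; for equal modes it comes from `occSign`.
    rcases lt_trichotomy (modeOf a) (modeOf b) with h' | h' | h'
    · simp only [belowSign_symmDiff, occSign_symmDiff, h', h'.not_gt, h'.ne, h'.ne', if_true,
        if_false]
      split_ifs <;> ring
    · have := hne h'
      rw [h']
      simp only [belowSign_symmDiff, occSign_symmDiff, lt_irrefl, if_true, if_false]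
      split_ifs <;> first | omega | ring
    · simp only [belowSign_symmDiff, occSign_symmDiff, h', h'.not_gt, h'.ne, h'.ne', if_true,
        if_false]
      split_ifs <;> ring
  · simp

theorem majorana_conjTranspose {n : ℕ} (a : Fin (2 * n)) :
    (majorana a).conjTranspose = majorana a := by
  unfold majorana creation
  split_ifs
  · simp [add_comm]
  · simp [Matrix.conjTranspose_smul, smul_sub]
    abel

/-! ## Words and monomials -/

theorem word_unitary {n : ℕ} (l : List (Fin (2 * n))) :
    (l.map majorana).prod.conjTranspose * (l.map majorana).prod = 1 := by
  induction l with
  | nil => simp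
  | cons a l ih =>
    rw [List.map_cons, List.prod_cons, Matrix.conjTranspose_mul, majorana_conjTranspose,
      Matrix.mul_assoc, ← Matrix.mul_assoc (majorana a), majorana_mul_self, Matrix.one_mul, ih]

theorem monomial_unitary {n : ℕ} (X : Finset (Fin (2 * n))) :
    (monomial X).conjTranspose * monomial X = 1 := by
  rw [monomial, Matrix.conjTranspose_smul, Matrix.smul_mul, Matrix.mul_smul, word_unitary, smul_smul]
  have : star (Complex.I ^ X.card.choose 2) * Complex.I ^ X.card.choose 2 = 1 := by
    rw [star_pow, ← mul_pow]; simp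
  rw [this, one_smul]

theorem monomial_unitary' {n : ℕ} (X : Finset (Fin (2 * n))) :
    monomial X * (monomial X).conjTranspose = 1 :=
  mul_eq_one_comm.mp (monomial_unitary X)

theorem majorana_mul_word {n : ℕ} (a : Fin (2 * n)) (l : List (Fin (2 * n))) :
    majorana a * (l.map majorana).prod =
      (l.map (fun b => if b = a then (1 : ℂ) else -1)).prod • ((l.map majorana).prod * majorana a) := by
  induction l with
  | nil => simp
  | cons b l ih =>
    simp only [List.map_cons, List.prod_cons]
    by_cases h : b = a
    · subst h
      rw [if_pos rfl, one_mul, mul_assoc (majorana b) _ (majorana b), ← mul_smul_comm, ← ih]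
    · rw [if_neg h, ← mul_assoc, majorana_anticomm (Ne.symm h), neg_mul, mul_assoc, ih, neg_one_mul,
        neg_smul, mul_smul_comm, mul_assoc]

theorem majorana_mul_monomial {n : ℕ} (a : Fin (2 * n)) (X : Finset (Fin (2 * n))) :
    majorana a * monomial X =
      ((-1) ^ X.card * (if a ∈ X then (-1 : ℂ) else 1)) • (monomial X * majorana a) := by
  have h : ((X.sort (· ≤ ·)).map (fun b => if b = a then (1 : ℂ) else -1)).prod =
      (-1) ^ X.card * (if a ∈ X then (-1 : ℂ) else 1) := by
    have : ((X.sort (· ≤ ·)).map (fun b => if b = a then (1 : ℂ) else -1)).prod =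
        ∏ b ∈ X, if b = a then (1 : ℂ) else -1 := by
      rw [Finset.prod_eq_multiset_prod, ← Finset.sort_eq X (· ≤ ·), Multiset.map_coe,
        Multiset.prod_coe]
    rw [this]
    have h2 : ∀ b ∈ X, (if b = a then (1 : ℂ) else -1) = (-1) * (if b = a then (-1 : ℂ) else 1) := by
      intro b _; split_ifs <;> simp
    rw [Finset.prod_congr rfl h2, Finset.prod_mul_distrib, Finset.prod_const,
      Finset.prod_ite_eq']
  rw [monomial, mul_smul_comm, majorana_mul_word, h, smul_mul_assoc, smul_comm]

/-- Conjugation by a Majorana monomial. -/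
noncomputable def conjBy {n : ℕ} (X : Finset (Fin (2 * n))) : FockOp n →ₐ[ℂ] FockOp n :=
  AlgHom.ofLinearMap
    { toFun := fun A => (monomial X).conjTranspose * A * monomial X
      map_add' := fun A B => by simp [mul_add, add_mul]
      map_smul' := fun c A => by simp }
    (by simpa using monomial_unitary X)
    (fun A B => by
      change _ * (A * B) * _ = _ * A * _ * (_ * B * _)
      have := monomial_unitary' X
      simp only [mul_assoc]
      rw [← mul_assoc (monomial X) (monomial X).conjTranspose, this, one_mul])

theorem conjBy_apply {n : ℕ} (X : Finset (Fin (2 * n))) (A : FockOp n) :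
    conjBy X A = (monomial X).conjTranspose * A * monomial X := rfl

theorem conjBy_majorana {n : ℕ} (X : Finset (Fin (2 * n))) (a : Fin (2 * n)) :
    conjBy X (majorana a) =
      ((-1) ^ X.card * (if a ∈ X then (-1 : ℂ) else 1)) • majorana a := by
  rw [conjBy_apply, mul_assoc, majorana_mul_monomial, mul_smul_comm, ← mul_assoc, monomial_unitary,
    one_mul]

/-- Each letter contributes `(-1)^|X|` and an incidence sign. Even length cancels the former.
Repeated letters are allowed, as they occur when rotated products are expanded. -/
theorem conjBy_word {n m : ℕ} (X : Finset (Fin (2 * n))) (f : Fin (2 * m) → Fin (2 * n)) :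
    conjBy X (List.ofFn (fun i => majorana (f i))).prod =
      (∏ i, if f i ∈ X then (-1 : ℂ) else 1) • (List.ofFn (fun i => majorana (f i))).prod := by
  rw [map_list_prod, List.map_ofFn]
  have h := (MultilinearMap.mkPiAlgebraFin ℂ (2 * m) (FockOp n)).map_smul_univ
    (fun i => (-1) ^ X.card * (if f i ∈ X then (-1 : ℂ) else 1)) (fun i => majorana (f i))
  simp only [MultilinearMap.mkPiAlgebraFin_apply] at h
  have e : (conjBy X ∘ fun i => majorana (f i)) = fun i =>
      ((-1) ^ X.card * (if f i ∈ X then (-1 : ℂ) else 1)) • majorana (f i) := by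
    funext i; simp [conjBy_majorana]
  rw [e, h, Finset.prod_mul_distrib, Finset.prod_const, Finset.card_univ, Fintype.card_fin,
    ← pow_mul, mul_comm X.card, mul_assoc, pow_mul]
  simp

/-! ## Permuting anticommuting factors -/

theorem prod_ofFn_swap {A : Type*} [Ring A] : ∀ (m : ℕ) (g : Fin (m + 1) → A)
    (_ : ∀ i j, i ≠ j → g i * g j = - (g j * g i)) (i : Fin m),
    (List.ofFn (fun x => g (Equiv.swap i.castSucc i.succ x))).prod = - (List.ofFn g).prod
  | 0, _, _, i => i.elim0
  | m + 1, g, hg, i => by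
    refine Fin.cases ?_ (fun i => ?_) i
    · rw [List.ofFn_succ, List.ofFn_succ, List.ofFn_succ, List.ofFn_succ]
      simp only [List.prod_cons, Fin.castSucc_zero, Equiv.swap_apply_left]
      have e1 : (Fin.succ 0 : Fin (m + 2)) = 1 := rfl
      have e2 : ∀ x : Fin m, Equiv.swap (0 : Fin (m + 2)) 1 x.succ.succ = x.succ.succ := fun x =>
        Equiv.swap_apply_of_ne_of_ne (Fin.succ_ne_zero _)
          (fun h => Fin.succ_ne_zero x (Fin.succ_injective _ (h.trans e1.symm)))
      simp only [e1, e2, Equiv.swap_apply_right]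
      rw [← mul_assoc, hg 1 0 (by simp), neg_mul, mul_assoc]
    · have := prod_ofFn_swap m (fun x => g x.succ)
        (fun a b hab => hg _ _ (fun h => hab (Fin.succ_injective _ h))) i
      rw [List.ofFn_succ, List.ofFn_succ (f := g), List.prod_cons, List.prod_cons, ← mul_neg, ← this]
      have e0 : Equiv.swap i.succ.castSucc i.succ.succ 0 = 0 :=
        Equiv.swap_apply_of_ne_of_ne (by simp [Fin.ext_iff]) (Fin.succ_ne_zero _).symm
      rw [e0]
      congr 3
      funext x
      congr 1
      rw [Fin.castSucc_succ]
      simp only [Equiv.swap_apply_def, Fin.succ_inj]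
      split_ifs <;> rfl

/-- Adjacent transpositions generate the symmetric group, and each costs one sign. -/
theorem prod_ofFn_perm {A : Type*} [Ring A] {m : ℕ} (σ : Equiv.Perm (Fin m)) (g : Fin m → A)
    (hg : ∀ i j, i ≠ j → g i * g j = - (g j * g i)) :
    (List.ofFn (fun x => g (σ x))).prod = ((Equiv.Perm.sign σ : ℤˣ) : ℤ) • (List.ofFn g).prod := by
  cases m with
  | zero => simp [Subsingleton.elim σ 1]
  | succ m =>
    have hσ : σ ∈ Submonoid.closure (Set.range fun i : Fin m => Equiv.swap i.castSucc i.succ) := by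
      rw [Equiv.Perm.mclosure_swap_castSucc_succ]; trivial
    induction hσ using Submonoid.closure_induction generalizing g with
    | mem x hx =>
      obtain ⟨i, rfl⟩ := hx
      rw [prod_ofFn_swap m g hg, Equiv.Perm.sign_swap (by simp [Fin.ext_iff])]
      simp
    | one => simp
    | mul x y _ _ hx hy =>
      have h1 := hy (fun z => g (x z)) (fun i j hij => hg _ _ (fun h => hij (x.injective h)))
      simp only [Equiv.Perm.mul_apply]
      rw [h1, hx g hg, smul_smul, map_mul, mul_comm]
      simp

/-! ## Rotated Majorana operators -/

/-- The Majorana operator `∑_a O_{u,a} γ_a`. -/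
noncomputable def rotMajorana {n : ℕ} (O : Matrix (Fin (2 * n)) (Fin (2 * n)) ℝ)
    (u : Fin (2 * n)) : FockOp n :=
  ∑ a, (O u a : ℂ) • majorana a

theorem rotMajorana_mul {n : ℕ} (O : Matrix (Fin (2 * n)) (Fin (2 * n)) ℝ) (u v : Fin (2 * n)) :
    rotMajorana O u * rotMajorana O v =
      ∑ a, ∑ b, ((O u a : ℂ) * (O v b : ℂ)) • (majorana a * majorana b) := by
  simp only [rotMajorana, Finset.sum_mul, Finset.mul_sum, smul_mul_smul_comm]
  rw [Finset.sum_comm]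

/-- By bilinearity and anticommutation only the terms with equal labels survive, which leaves the
inner product of rows `u` and `v`. -/
theorem rotMajorana_car {n : ℕ} (O : Matrix (Fin (2 * n)) (Fin (2 * n)) ℝ) (u v : Fin (2 * n)) :
    rotMajorana O u * rotMajorana O v + rotMajorana O v * rotMajorana O u =
      (2 * ((O * O.transpose) u v : ℂ)) • (1 : FockOp n) := by
  rw [rotMajorana_mul, rotMajorana_mul, Finset.sum_comm (f := fun a b =>
    ((O v a : ℂ) * (O u b : ℂ)) • (majorana a * majorana b)), ← Finset.sum_add_distrib]
  have h : ∀ a, ((∑ b, ((O u a : ℂ) * (O v b : ℂ)) • (majorana a * majorana b)) +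
      ∑ b, ((O v b : ℂ) * (O u a : ℂ)) • (majorana b * majorana a)) =
      (2 * ((O u a : ℂ) * (O v a : ℂ))) • (1 : FockOp n) := by
    intro a
    rw [← Finset.sum_add_distrib, Finset.sum_eq_single a]
    · rw [majorana_mul_self, ← add_smul]; congr 1; ring
    · intro b _ hb
      rw [majorana_anticomm hb, mul_comm, smul_neg, add_neg_cancel]
    · simp
  simp only [h, ← Finset.sum_smul]
  congr 1
  simp [Matrix.mul_apply, Finset.mul_sum]

theorem rotMajorana_anticomm {n : ℕ} {O : Matrix (Fin (2 * n)) (Fin (2 * n)) ℝ}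
    (hO : O ∈ Matrix.orthogonalGroup (Fin (2 * n)) ℝ) {u v : Fin (2 * n)} (h : u ≠ v) :
    rotMajorana O u * rotMajorana O v = - (rotMajorana O v * rotMajorana O u) := by
  have := rotMajorana_car O u v
  have h1 : O * O.transpose = 1 := (Matrix.mem_orthogonalGroup_iff _ _).mp hO
  rw [h1, Matrix.one_apply_ne h] at this
  exact eq_neg_of_add_eq_zero_left (by simpa using this)

theorem rotMajorana_mul_self {n : ℕ} {O : Matrix (Fin (2 * n)) (Fin (2 * n)) ℝ}
    (hO : O ∈ Matrix.orthogonalGroup (Fin (2 * n)) ℝ) (u : Fin (2 * n)) :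
    rotMajorana O u * rotMajorana O u = 1 := by
  have := rotMajorana_car O u u
  have h1 : O * O.transpose = 1 := (Matrix.mem_orthogonalGroup_iff _ _).mp hO
  rw [h1, Matrix.one_apply_eq, ← two_smul ℂ, Complex.ofReal_one, mul_one] at this
  exact smul_right_injective _ (two_ne_zero : (2 : ℂ) ≠ 0) this

theorem rotMajorana_conjTranspose {n : ℕ} (O : Matrix (Fin (2 * n)) (Fin (2 * n)) ℝ)
    (u : Fin (2 * n)) : (rotMajorana O u).conjTranspose = rotMajorana O u := by
  simp [rotMajorana, Matrix.conjTranspose_sum, Matrix.conjTranspose_smul, majorana_conjTranspose]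

/-- The first Majorana label of a mode. -/
def loLabel {n : ℕ} (j : Fin n) : Fin (2 * n) := ⟨2 * j.val, by omega⟩

/-- The second Majorana label of a mode. -/
def hiLabel {n : ℕ} (j : Fin n) : Fin (2 * n) := ⟨2 * j.val + 1, by omega⟩

theorem loLabel_lt_hiLabel {n : ℕ} (j : Fin n) : loLabel j < hiLabel j := by
  simp [loLabel, hiLabel, Fin.lt_def]

theorem sort_eq_ofFn {n m : ℕ} (S : Label n m) :
    S.1.sort (· ≤ ·) = List.ofFn (S.1.orderEmbOfFin S.2) := by
  rw [← Finset.listMap_orderEmbOfFin_finRange S.1 S.2, List.ofFn_eq_map]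

theorem monomial_eq_ofFn {n m : ℕ} (S : Label n m) :
    monomial S.1 = Complex.I ^ (m.choose 2) •
      (List.ofFn (fun i => majorana (S.1.orderEmbOfFin S.2 i))).prod := by
  rw [monomial, sort_eq_ofFn, List.map_ofFn, S.2]
  rfl

theorem sum_label_two {n : ℕ} {A : Type*} [AddCommMonoid A] (φ : Fin (2 * n) → Fin (2 * n) → A) :
    ∑ S : Label n 2, φ (S.1.orderEmbOfFin S.2 0) (S.1.orderEmbOfFin S.2 1) =
      ∑ p ∈ Finset.univ.filter (fun p : Fin (2 * n) × Fin (2 * n) => p.1 < p.2), φ p.1 p.2 := by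
  refine Finset.sum_bij (fun S _ => (S.1.orderEmbOfFin S.2 0, S.1.orderEmbOfFin S.2 1)) ?_ ?_ ?_ ?_
  · intro S _
    simp
  · intro S _ S' _ h
    simp only [Prod.mk.injEq] at h
    apply Subtype.ext
    rw [← Finset.image_orderEmbOfFin_univ S.1 S.2, ← Finset.image_orderEmbOfFin_univ S'.1 S'.2]
    congr 1
    funext i
    fin_cases i
    · exact h.1
    · exact h.2
  · rintro ⟨a, b⟩ hab
    simp only [Finset.mem_filter, Finset.mem_univ, true_and] at hab
    have hc : ({a, b} : Finset (Fin (2 * n))).card = 2 := Finset.card_pair hab.ne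
    refine ⟨⟨{a, b}, hc⟩, Finset.mem_univ _, ?_⟩
    have := Finset.orderEmbOfFin_unique hc (f := ![a, b])
      (by intro x; fin_cases x <;> simp)
      (by
        intro x y hxy
        fin_cases x <;> fin_cases y <;> simp_all)
    simp [← this]
  · intro S _; rfl

theorem orderEmbOfFin_singleMode {n : ℕ} (j : Fin n) :
    ⇑((singleMode j).label.1.orderEmbOfFin (singleMode j).label.2) = ![loLabel j, hiLabel j] := by
  symm
  apply Finset.orderEmbOfFin_unique
  · intro x
    fin_cases x <;> simp [ModeSet.label, modeLabels, singleMode, modeOf, loLabel, hiLabel, Fin.ext_iff]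
    omega
  · intro x y hxy
    have := loLabel_lt_hiLabel j
    fin_cases x <;> fin_cases y <;> simp_all

/-- A `2 × 2` minor is the antisymmetrized coefficient of `γ_a γ_b` in the product of the two
rotated operators. The diagonal terms of that product add up to the inner product of two distinct
rows, hence vanish. -/
theorem rotated_singleMode {n : ℕ} {O : Matrix (Fin (2 * n)) (Fin (2 * n)) ℝ}
    (hO : O ∈ Matrix.orthogonalGroup (Fin (2 * n)) ℝ) (j : Fin n) :
    rotated O (singleMode j).label =
      Complex.I • (rotMajorana O (loLabel j) * rotMajorana O (hiLabel j)) := by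
  set u := loLabel j
  set v := hiLabel j
  have huv : u ≠ v := (loLabel_lt_hiLabel j).ne
  have h1 : O * O.transpose = 1 := (Matrix.mem_orthogonalGroup_iff _ _).mp hO
  have horth : ∑ a, (O u a : ℂ) * (O v a : ℂ) = 0 := by
    have := congrFun (congrFun h1 u) v
    rw [Matrix.one_apply_ne huv, Matrix.mul_apply] at this
    simp only [Matrix.transpose_apply] at this
    exact_mod_cast this
  have hL : rotated O (singleMode j).label =
      ∑ S : Label n 2, (fun a b => Complex.I • (((O u a : ℂ) * (O v b : ℂ) -
        (O u b : ℂ) * (O v a : ℂ)) • (majorana a * majorana b)))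
          (S.1.orderEmbOfFin S.2 0) (S.1.orderEmbOfFin S.2 1) := by
    unfold rotated
    refine Finset.sum_congr rfl fun S _ => ?_
    rw [monomial_eq_ofFn S]
    have hm : minor O (singleMode j).label S =
        O u (S.1.orderEmbOfFin S.2 0) * O v (S.1.orderEmbOfFin S.2 1) -
        O u (S.1.orderEmbOfFin S.2 1) * O v (S.1.orderEmbOfFin S.2 0) := by
      unfold minor
      rw [orderEmbOfFin_singleMode, Matrix.det_fin_two]
      simp [Matrix.submatrix_apply, u, v]
    rw [hm, smul_comm]
    simp [List.ofFn_succ]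
  refine hL.trans ((sum_label_two (fun a b => Complex.I • (((O u a : ℂ) * (O v b : ℂ) -
    (O u b : ℂ) * (O v a : ℂ)) • (majorana a * majorana b)))).trans ?_)
  rw [rotMajorana_mul, ← Finset.smul_sum]
  congr 1
  rw [← Finset.univ_product_univ, ← Finset.sum_product' (f := fun a b =>
    ((O u a : ℂ) * (O v b : ℂ)) • (majorana a * majorana b)), Finset.univ_product_univ]
  have split : ∀ h : Fin (2 * n) × Fin (2 * n) → FockOp n, ∑ p, h p =
      ∑ p ∈ Finset.univ.filter (fun p : Fin (2 * n) × Fin (2 * n) => p.1 < p.2), (h p + h p.swap) +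
      ∑ a, h (a, a) := by
    intro h
    rw [← Finset.sum_filter_add_sum_filter_not Finset.univ
      (fun p : Fin (2 * n) × Fin (2 * n) => p.1 < p.2), Finset.sum_add_distrib, add_assoc]
    congr 1
    rw [← Finset.sum_filter_add_sum_filter_not (Finset.univ.filter
      (fun p : Fin (2 * n) × Fin (2 * n) => ¬ p.1 < p.2)) (fun p => p.2 < p.1)]
    congr 1
    · refine Finset.sum_bij' (fun p _ => p.swap) (fun p _ => p.swap) ?_ ?_ ?_ ?_ ?_ <;> simp +contextual
      intro a b h; exact h.le
    · refine Finset.sum_bij' (fun p _ => p.1) (fun a _ => (a, a)) ?_ ?_ ?_ ?_ ?_ <;>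
        simp +contextual [le_antisymm_iff]
      intro a b h1 h2; rw [le_antisymm h1 h2]
  rw [split]
  have hd : ∑ a, ((O u a : ℂ) * (O v a : ℂ)) • (majorana a * majorana a : FockOp n) = 0 := by
    simp only [majorana_mul_self]
    rw [← Finset.sum_smul, horth, zero_smul]
  rw [hd, add_zero]
  refine Finset.sum_congr rfl fun p hp => ?_
  simp only [Finset.mem_filter, Finset.mem_univ, true_and] at hp
  simp only [Prod.fst_swap, Prod.snd_swap]
  rw [majorana_anticomm hp.ne', smul_neg, ← sub_eq_add_neg, ← sub_smul]

/-! ## The commuting pair observables -/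

/-- The rotated observable of a single mode. -/
noncomputable def pairObs {n : ℕ} (O : Matrix (Fin (2 * n)) (Fin (2 * n)) ℝ) (j : Fin n) :
    FockOp n :=
  rotated O (singleMode j).label

theorem pairObs_conjTranspose {n : ℕ} {O : Matrix (Fin (2 * n)) (Fin (2 * n)) ℝ}
    (hO : O ∈ Matrix.orthogonalGroup (Fin (2 * n)) ℝ) (j : Fin n) :
    (pairObs O j).conjTranspose = pairObs O j := by
  rw [pairObs, rotated_singleMode hO, Matrix.conjTranspose_smul, Matrix.conjTranspose_mul,
    rotMajorana_conjTranspose, rotMajorana_conjTranspose,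
    rotMajorana_anticomm hO (loLabel_lt_hiLabel j).ne']
  simp

theorem pairObs_mul_self {n : ℕ} {O : Matrix (Fin (2 * n)) (Fin (2 * n)) ℝ}
    (hO : O ∈ Matrix.orthogonalGroup (Fin (2 * n)) ℝ) (j : Fin n) :
    pairObs O j * pairObs O j = 1 := by
  rw [pairObs, rotated_singleMode hO, smul_mul_smul_comm, Complex.I_mul_I, mul_assoc,
    ← mul_assoc (rotMajorana O (hiLabel j)), rotMajorana_anticomm hO (loLabel_lt_hiLabel j).ne',
    neg_mul, mul_assoc, rotMajorana_mul_self hO, mul_one, mul_neg, rotMajorana_mul_self hO]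
  simp

theorem pairObs_commute {n : ℕ} {O : Matrix (Fin (2 * n)) (Fin (2 * n)) ℝ}
    (hO : O ∈ Matrix.orthogonalGroup (Fin (2 * n)) ℝ) (j l : Fin n) :
    Commute (pairObs O j) (pairObs O l) := by
  by_cases h : j = l
  · rw [h]
  have hv : j.val ≠ l.val := fun e => h (Fin.ext e)
  rw [pairObs, pairObs, rotated_singleMode hO, rotated_singleMode hO]
  have key : ∀ u v w : Fin (2 * n), u ≠ w → v ≠ w →
      Commute (rotMajorana O u * rotMajorana O v) (rotMajorana O w) := by
    intro u v w hu hv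
    rw [Commute, SemiconjBy, mul_assoc, rotMajorana_anticomm hO hv, mul_neg, ← mul_assoc,
      rotMajorana_anticomm hO hu, neg_mul, neg_neg, mul_assoc]
  refine (Commute.smul_right ?_ _).smul_left _
  refine Commute.mul_right (key _ _ _ ?_ ?_) (key _ _ _ ?_ ?_) <;>
    simp [loLabel, hiLabel, Fin.ext_iff] <;> omega

/-- The spectral projection of a pair observable. -/
noncomputable def pairProj {n : ℕ} (O : Matrix (Fin (2 * n)) (Fin (2 * n)) ℝ) (q : Fin n → ℤˣ)
    (j : Fin n) : FockOp n :=
  (1 / 2 : ℂ) • (1 + (((q j : ℤˣ) : ℤ) : ℂ) • pairObs O j)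

theorem list_prod_projection {A : Type*} [Ring A] [StarRing A] (l : List A)
    (hs : ∀ a ∈ l, star a = a) (hi : ∀ a ∈ l, a * a = a) (hc : ∀ a ∈ l, ∀ b ∈ l, Commute a b) :
    star l.prod = l.prod ∧ l.prod * l.prod = l.prod := by
  induction l with
  | nil => simp
  | cons a l ih =>
    obtain ⟨h1, h2⟩ := ih (fun b hb => hs b (by simp [hb])) (fun b hb => hi b (by simp [hb]))
      (fun b hb c hc' => hc b (by simp [hb]) c (by simp [hc']))
    have h3 : Commute a l.prod := Commute.list_prod_right _ _ (fun b hb => hc a (by simp) b (by simp [hb]))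
    rw [List.prod_cons]
    refine ⟨?_, ?_⟩
    · rw [star_mul, h1, hs a (by simp), h3.eq]
    · rw [mul_assoc, ← mul_assoc l.prod, ← h3.eq, mul_assoc a, h2, ← mul_assoc, hi a (by simp)]

/-- Conjugation is multiplicative, so the inner factors `γ_X γ_X†` cancel; of the `n` factors
`2^(-2n)` the prefactor leaves one. -/
theorem parent_eq {n : ℕ} (hn : 0 < n) (O : Matrix (Fin (2 * n)) (Fin (2 * n)) ℝ) (q : Fin n → ℤˣ)
    (X : Finset (Fin (2 * n))) :
    parent O q X = ((2 : ℂ) ^ (2 * n))⁻¹ • conjBy X (List.ofFn (pairProj O q)).prod := by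
  have h : ∀ j, pairEffect O j (q j) X = ((2 : ℂ) ^ (2 * n))⁻¹ • conjBy X (pairProj O q j) :=
    fun j => rfl
  unfold parent
  simp only [h]
  have h2 := (MultilinearMap.mkPiAlgebraFin ℂ n (FockOp n)).map_smul_univ
    (fun _ => ((2 : ℂ) ^ (2 * n))⁻¹) (fun j => conjBy X (pairProj O q j))
  simp only [MultilinearMap.mkPiAlgebraFin_apply] at h2
  rw [h2, smul_smul, map_list_prod, List.map_ofFn]
  congr 1
  rw [Finset.prod_const, Finset.card_univ, Fintype.card_fin]
  obtain ⟨m, rfl⟩ : ∃ m, n = m + 1 := ⟨n - 1, by omega⟩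
  rw [Nat.add_sub_cancel, pow_succ, ← mul_assoc, ← mul_pow, mul_inv_cancel₀ (by positivity), one_pow,
    one_mul]

/-- The product `P` of commuting projections is a projection, so the effect is a positive multiple
of `(P γ_X)† (P γ_X)`. -/
theorem parent_posSemidef {n : ℕ} (hn : 0 < n) {O : Matrix (Fin (2 * n)) (Fin (2 * n)) ℝ}
    (hO : O ∈ Matrix.orthogonalGroup (Fin (2 * n)) ℝ) (q : Fin n → ℤˣ)
    (X : Finset (Fin (2 * n))) : (parent O q X).PosSemidef := by
  rw [parent_eq hn]
  have hq : ∀ j, (((q j : ℤˣ) : ℤ) : ℂ) * (((q j : ℤˣ) : ℤ) : ℂ) = 1 := fun j => by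
    rcases Int.units_eq_one_or (q j) with h | h <;> simp [h]
  have hst : ∀ j, star (((q j : ℤˣ) : ℤ) : ℂ) = (((q j : ℤˣ) : ℤ) : ℂ) := fun j => by simp
  obtain ⟨h1, h2⟩ := list_prod_projection (List.ofFn (pairProj O q))
    (by
      intro a ha
      obtain ⟨j, rfl⟩ := (List.mem_ofFn' _ _).mp ha
      rw [pairProj, star_smul, star_add, star_smul, hst, star_one, Matrix.star_eq_conjTranspose,
        pairObs_conjTranspose hO]
      simp)
    (by
      intro a ha
      obtain ⟨j, rfl⟩ := (List.mem_ofFn' _ _).mp ha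
      rw [pairProj, smul_mul_smul_comm, add_mul, mul_add, mul_add, smul_mul_smul_comm, hq,
        pairObs_mul_self hO, one_mul, mul_one, one_mul, one_smul]
      module)
    (by
      intro a ha b hb
      obtain ⟨j, rfl⟩ := (List.mem_ofFn' _ _).mp ha
      obtain ⟨l, rfl⟩ := (List.mem_ofFn' _ _).mp hb
      refine (Commute.smul_right ?_ _).smul_left _
      refine Commute.add_left (Commute.one_left _) (Commute.add_right (Commute.one_right _) ?_)
      exact ((pairObs_commute hO j l).smul_right _).smul_left _)
  have h3 : conjBy X (List.ofFn (pairProj O q)).prod =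
      ((List.ofFn (pairProj O q)).prod * monomial X).conjTranspose *
        ((List.ofFn (pairProj O q)).prod * monomial X) := by
    rw [conjBy_apply, Matrix.conjTranspose_mul, ← Matrix.star_eq_conjTranspose (List.prod _), h1,
      mul_assoc, mul_assoc, ← mul_assoc (List.prod _) (List.prod _), h2]
  rw [h3]
  refine (Matrix.posSemidef_conjTranspose_mul_self _).smul ?_
  have : (0 : ℝ) ≤ ((2 : ℝ) ^ (2 * n))⁻¹ := by positivity
  have e : ((2 : ℂ) ^ (2 * n))⁻¹ = ((((2 : ℝ) ^ (2 * n))⁻¹ : ℝ) : ℂ) := by push_cast; rfl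
  rw [e]
  exact_mod_cast this

/-! ## Marginals of the parent measurement -/

theorem prod_ofFn_sum {n : ℕ} {A ι : Type*} [Ring A] [Algebra ℂ A] [Fintype ι]
    (F : Fin n → ι → A) :
    (List.ofFn (fun j => ∑ x, F j x)).prod = ∑ q : Fin n → ι, (List.ofFn (fun j => F j (q j))).prod := by
  classical
  have := (MultilinearMap.mkPiAlgebraFin ℂ n A).map_sum F
  simpa only [MultilinearMap.mkPiAlgebraFin_apply] using this

theorem prod_ofFn_smul {n : ℕ} {A : Type*} [Ring A] [Algebra ℂ A] (c : Fin n → ℂ) (F : Fin n → A) :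
    (List.ofFn (fun j => c j • F j)).prod = (∏ j, c j) • (List.ofFn F).prod := by
  have := (MultilinearMap.mkPiAlgebraFin ℂ n A).map_smul_univ c F
  simpa only [MultilinearMap.mkPiAlgebraFin_apply] using this

/-- The sum factorizes over modes: weight `q_j` turns the spectral projections into the observable,
weight `1` into the identity. -/
theorem sum_pairProj {n : ℕ} (O : Matrix (Fin (2 * n)) (Fin (2 * n)) ℝ) (T : Finset (Fin n)) :
    ∑ q : Fin n → ℤˣ, (∏ j ∈ T, (((q j : ℤˣ) : ℤ) : ℂ)) • (List.ofFn (pairProj O q)).prod =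
      (List.ofFn (fun j => if j ∈ T then pairObs O j else 1)).prod := by
  have h : ∀ j, (if j ∈ T then pairObs O j else 1) = ∑ x : ℤˣ,
      (if j ∈ T then ((x : ℤ) : ℂ) else 1) • ((1 / 2 : ℂ) • (1 + ((x : ℤ) : ℂ) • pairObs O j)) := by
    intro j
    rw [show (Finset.univ : Finset ℤˣ) = {1, -1} from rfl, Finset.sum_pair (by decide)]
    split_ifs
    · simp only [Units.val_one, Units.val_neg]; push_cast; module
    · simp only [Units.val_one, Units.val_neg]; push_cast; module
  simp only [h]
  rw [prod_ofFn_sum (fun j (x : ℤˣ) => (if j ∈ T then ((x : ℤ) : ℂ) else 1) •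
    ((1 / 2 : ℂ) • (1 + ((x : ℤ) : ℂ) • pairObs O j)))]
  refine Finset.sum_congr rfl fun q _ => ?_
  rw [prod_ofFn_smul, Finset.prod_ite_mem, Finset.univ_inter]
  rfl

theorem sum_parent {n : ℕ} (hn : 0 < n) (O : Matrix (Fin (2 * n)) (Fin (2 * n)) ℝ) :
    ∑ q, ∑ X, parent O q X = 1 := by
  rw [Finset.sum_comm]
  simp only [parent_eq hn, ← Finset.smul_sum, ← map_sum]
  have := sum_pairProj O ∅
  simp only [Finset.prod_empty, one_smul, Finset.notMem_empty, if_false] at this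
  have h2 : (List.ofFn (fun _ : Fin n => (1 : FockOp n))).prod = 1 := by simp
  have hc : ((Finset.univ : Finset (Finset (Fin (2 * n)))).card : ℂ) = 2 ^ (2 * n) := by simp
  simp only [this, h2, map_one, Finset.sum_const]
  rw [← Nat.cast_smul_eq_nsmul ℂ, hc, smul_smul, inv_mul_cancel₀ (by positivity), one_smul]

theorem jointMeasurement_isPOVM {n N : ℕ} (hn : 0 < n) (hN : 0 < N)
    {O : Fin N → Matrix (Fin (2 * n)) (Fin (2 * n)) ℝ}
    (hO : ∀ r, O r ∈ Matrix.orthogonalGroup (Fin (2 * n)) ℝ) : IsPOVM (jointMeasurement O) := by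
  constructor
  · intro ω
    refine (parent_posSemidef hn (hO _) _ _).smul ?_
    have : (0 : ℝ) ≤ (N : ℝ)⁻¹ := by positivity
    have e : (N : ℂ)⁻¹ = (((N : ℝ)⁻¹ : ℝ) : ℂ) := by push_cast; rfl
    rw [e]
    exact_mod_cast this
  · simp only [jointMeasurement, Fintype.sum_prod_type, ← Finset.smul_sum, sum_parent hn]
    rw [Finset.sum_const, Finset.card_univ, Fintype.card_fin, ← Nat.cast_smul_eq_nsmul ℂ, smul_smul,
      inv_mul_cancel₀ (by positivity), one_smul]

/-! ## Moments of the estimator -/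

theorem list_prod_map_ite {ι A : Type*} [DecidableEq ι] [Monoid A] (T : Finset ι) (F : ι → A)
    (l : List ι) :
    (l.map (fun j => if j ∈ T then F j else 1)).prod = ((l.filter (· ∈ T)).map F).prod := by
  induction l with
  | nil => simp
  | cons a l ih =>
    by_cases h : a ∈ T <;> simp [h, ih]

theorem finRange_filter_mem {n : ℕ} (T : Finset (Fin n)) :
    (List.finRange n).filter (· ∈ T) = T.sort (· ≤ ·) := by
  have hn : ((List.finRange n).filter (· ∈ T)).Nodup := (List.nodup_finRange n).filter _
  have hs : ((List.finRange n).filter (· ∈ T)).Pairwise (· ≤ ·) :=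
    (List.pairwise_le_finRange n).filter _
  have := (List.toFinset_sort (· ≤ ·) hn).mpr hs
  rw [← this]
  congr 1
  ext; simp

theorem sort_modeLabels {n : ℕ} (T : Finset (Fin n)) :
    (modeLabels T).sort (· ≤ ·) = (T.sort (· ≤ ·)).flatMap (fun j => [loLabel j, hiLabel j]) := by
  have hs : ((T.sort (· ≤ ·)).flatMap (fun j => [loLabel j, hiLabel j])).Pairwise (· < ·) := by
    rw [List.pairwise_flatMap]
    refine ⟨fun j _ => by simpa using loLabel_lt_hiLabel j, ?_⟩
    refine (Finset.sortedLT_sort T).pairwise.imp ?_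
    intro a b hab x hx y hy
    simp only [List.mem_cons, List.not_mem_nil, or_false] at hx hy
    rw [Fin.lt_def] at hab ⊢
    rcases hx with rfl | rfl <;> rcases hy with rfl | rfl <;> simp [loLabel, hiLabel] <;> omega
  have hn := hs.imp (fun {a b} (h : a < b) => h.ne)
  have := (List.toFinset_sort (· ≤ ·) hn).mpr (hs.imp (fun h => h.le))
  rw [← this]
  congr 1
  ext m
  simp only [modeLabels, Finset.mem_filter, Finset.mem_univ, true_and, List.mem_toFinset,
    List.mem_flatMap, Finset.mem_sort, List.mem_cons, List.not_mem_nil, or_false]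
  constructor
  · intro h
    refine ⟨_, h, ?_⟩
    simp only [loLabel, hiLabel, modeOf, Fin.ext_iff]
    omega
  · rintro ⟨j, hj, h⟩
    have : modeOf m = j := by
      simp only [loLabel, hiLabel, modeOf, Fin.ext_iff] at h ⊢
      omega
    rwa [this]

/-- Labels of successive modes are already in ascending order, so no reordering sign appears; each
mode contributes one factor `i`. -/
theorem prod_pairObs {n k : ℕ} {O : Matrix (Fin (2 * n)) (Fin (2 * n)) ℝ}
    (hO : O ∈ Matrix.orthogonalGroup (Fin (2 * n)) ℝ) (T : ModeSet n k) :
    (List.ofFn (fun j => if j ∈ T.1 then pairObs O j else 1)).prod =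
      Complex.I ^ k • (List.ofFn (fun i =>
        rotMajorana O (T.label.1.orderEmbOfFin T.label.2 i))).prod := by
  rw [List.ofFn_eq_map, list_prod_map_ite, finRange_filter_mem]
  have h : List.ofFn (fun i => rotMajorana O (T.label.1.orderEmbOfFin T.label.2 i)) =
      (T.label.1.sort (· ≤ ·)).map (rotMajorana O) := by
    rw [sort_eq_ofFn, List.map_ofFn]; rfl
  rw [h]
  change _ = _ • (((modeLabels T.1).sort (· ≤ ·)).map (rotMajorana O)).prod
  rw [sort_modeLabels]
  have key : ∀ l : List (Fin n), (l.map (pairObs O)).prod = Complex.I ^ l.length •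
      ((l.flatMap (fun j => [loLabel j, hiLabel j])).map (rotMajorana O)).prod := by
    intro l
    induction l with
    | nil => simp
    | cons a l ih =>
      rw [List.map_cons, List.prod_cons, ih, pairObs, rotated_singleMode hO]
      simp only [List.length_cons, List.flatMap_cons, List.map_append, List.prod_append,
        List.map_cons, List.map_nil, List.prod_cons, List.prod_nil, mul_one]
      rw [smul_mul_smul_comm, pow_succ']
  rw [key, Finset.length_sort, T.2]

/-- Since `|S| = 2k`, the product `|X||S|` is even. It also dominates `|S ∩ X|`, so the natural
subtraction does not truncate. -/
theorem xSign_eq {n k : ℕ} (X : Finset (Fin (2 * n))) (S : Label n (2 * k)) :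
    xSign X S.1 = ∏ a ∈ S.1, if a ∈ X then (-1 : ℝ) else 1 := by
  have h : ∏ a ∈ S.1, (if a ∈ X then (-1 : ℝ) else 1) = (-1) ^ (S.1 ∩ X).card := by
    rw [Finset.prod_ite, Finset.filter_mem_eq_inter]; simp
  rw [h, xSign]
  have hle : (S.1 ∩ X).card ≤ X.card * S.1.card := by
    rcases Nat.eq_zero_or_pos S.1.card with h0 | h0
    · rw [Finset.card_eq_zero] at h0; simp [h0]
    · exact (Finset.card_le_card Finset.inter_subset_right).trans (Nat.le_mul_of_pos_right _ h0)
  have he : Even (X.card * S.1.card) := by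
    rw [S.2]; exact (even_two_mul k).mul_left _
  have h1 : (-1 : ℝ) ^ (X.card * S.1.card - (S.1 ∩ X).card) * (-1) ^ (S.1 ∩ X).card = 1 := by
    rw [← pow_add, Nat.sub_add_cancel hle, he.neg_one_pow]
  have h2 : (-1 : ℝ) ^ (S.1 ∩ X).card * (-1) ^ (S.1 ∩ X).card = 1 := by
    rw [← mul_pow]; simp
  linear_combination (-1 : ℝ) ^ (S.1 ∩ X).card * h1 -
    (-1 : ℝ) ^ (X.card * S.1.card - (S.1 ∩ X).card) * h2

/-- Orthogonality of sign characters on subsets: the two signs agree when the letters are exactly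
`S`, and otherwise the sum over `X` cancels. -/
theorem sum_xSign_conjBy_word {n k : ℕ} (S : Label n (2 * k)) (f : Fin (2 * k) → Fin (2 * n)) :
    ∑ X, (xSign X S.1 : ℂ) • conjBy X (List.ofFn (fun i => majorana (f i))).prod =
      if Finset.univ.image f = S.1 then
        (2 : ℂ) ^ (2 * n) • (List.ofFn (fun i => majorana (f i))).prod else 0 := by
  simp only [conjBy_word, smul_smul, ← Finset.sum_smul]
  have hx : ∀ X, (xSign X S.1 : ℂ) = ∏ a ∈ S.1, if a ∈ X then (-1 : ℂ) else 1 := by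
    intro X
    rw [xSign_eq, Complex.ofReal_prod]
    refine Finset.prod_congr rfl fun a _ => ?_
    split_ifs <;> simp
  simp only [hx]
  split_ifs with h
  · congr 1
    have hinj : Function.Injective f := by
      have : (Finset.univ.image f).card = (Finset.univ : Finset (Fin (2 * k))).card := by
        rw [h, S.2]; simp
      simpa using Finset.card_image_iff.mp this
    have h1 : ∀ X : Finset (Fin (2 * n)), (∏ a ∈ S.1, if a ∈ X then (-1 : ℂ) else 1) *
        ∏ i, (if f i ∈ X then (-1 : ℂ) else 1) = 1 := by
      intro X
      rw [← h, Finset.prod_image (fun a _ b _ hab => hinj hab), ← Finset.prod_mul_distrib]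
      refine Finset.prod_eq_one fun i _ => ?_
      split_ifs <;> simp
    simp only [h1]
    simp
  -- The word has only `2k = |S|` letters, so it misses some `a ∈ S`. Toggling `a` in `X` flips
  -- `x_S` and nothing else.
  · have hns : ∃ a ∈ S.1, a ∉ Finset.univ.image f := by
      by_contra! hc
      refine h (Finset.eq_of_subset_of_card_le hc ?_).symm
      rw [S.2]
      exact Finset.card_image_le.trans (by simp)
    obtain ⟨a, ha, haf⟩ := hns
    have hz : ∑ X : Finset (Fin (2 * n)), (∏ a ∈ S.1, if a ∈ X then (-1 : ℂ) else 1) *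
        ∏ i, (if f i ∈ X then (-1 : ℂ) else 1) = 0 := by
      have hs : ∀ X : Finset (Fin (2 * n)), (∏ b ∈ S.1, if b ∈ symmDiff X {a} then (-1 : ℂ) else 1) *
          ∏ i, (if f i ∈ symmDiff X {a} then (-1 : ℂ) else 1) =
          - ((∏ b ∈ S.1, if b ∈ X then (-1 : ℂ) else 1) *
            ∏ i, (if f i ∈ X then (-1 : ℂ) else 1)) := by
        intro X
        have e1 : ∀ b, (if b ∈ symmDiff X {a} then (-1 : ℂ) else 1) =
            (if b = a then -1 else 1) * if b ∈ X then (-1 : ℂ) else 1 := by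
          intro b
          by_cases h2 : b = a
          · subst h2; by_cases h1 : b ∈ X <;> simp [Finset.mem_symmDiff, h1]
          · by_cases h1 : b ∈ X <;> simp [Finset.mem_symmDiff, h1, h2]
        have e2 : ∀ i, (if f i ∈ symmDiff X {a} then (-1 : ℂ) else 1) =
            if f i ∈ X then (-1 : ℂ) else 1 := by
          intro i
          have : f i ≠ a := fun e => haf (by simp [← e])
          rw [e1, if_neg this, one_mul]
        simp only [e2]
        simp only [e1 _]
        rw [Finset.prod_mul_distrib, Finset.prod_ite_eq' S.1 a, if_pos ha]
        ring
      have hinv : Function.Involutive (fun X : Finset (Fin (2 * n)) => symmDiff X {a}) := by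
        intro X; simp
      have := Fintype.sum_equiv (hinv.toPerm _)
        (fun X : Finset (Fin (2 * n)) => - ((∏ b ∈ S.1, if b ∈ X then (-1 : ℂ) else 1) *
            ∏ i, (if f i ∈ X then (-1 : ℂ) else 1)))
        (fun X => (∏ b ∈ S.1, if b ∈ X then (-1 : ℂ) else 1) *
            ∏ i, (if f i ∈ X then (-1 : ℂ) else 1)) (fun X => (hs X).symm)
      rw [Finset.sum_neg_distrib] at this
      exact CharZero.neg_eq_self_iff.mp this
    rw [hz, zero_smul]

/-- The exponent `k(2k - 1)` is `k + 2k(k - 1)`, congruent to `k` modulo `4`. This matches the phase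
of `γ_S` with the one factor `i` per pair. -/
theorem I_pow_choose_two (k : ℕ) : Complex.I ^ ((2 * k).choose 2) = Complex.I ^ k := by
  rw [Nat.choose_two_right]
  have h : 2 * k * (2 * k - 1) / 2 = k * (2 * k - 1) := by
    rw [mul_assoc, Nat.mul_div_cancel_left _ (by norm_num)]
  rw [h]
  rcases Nat.eq_zero_or_pos k with rfl | hk
  · simp
  obtain ⟨l, rfl⟩ : ∃ l, k = l + 1 := ⟨k - 1, by omega⟩
  have e : (l + 1) * (2 * (l + 1) - 1) = (l + 1) + 2 * (l * (l + 1)) := by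
    have : 2 * (l + 1) - 1 = 2 * l + 1 := by omega
    rw [this]; ring
  rw [e, pow_add, pow_mul, Complex.I_sq, (Nat.even_mul_succ_self l).neg_one_pow, mul_one]

theorem sum_image_eq_label {n m : ℕ} {A : Type*} [AddCommMonoid A] (S : Label n m)
    (φ : (Fin m → Fin (2 * n)) → A) :
    ∑ f, (if Finset.univ.image f = S.1 then φ f else 0) =
      ∑ σ : Equiv.Perm (Fin m), φ (fun i => S.1.orderEmbOfFin S.2 (σ i)) := by
  rw [← Finset.sum_filter]
  symm
  refine Finset.sum_bij (fun σ _ i => S.1.orderEmbOfFin S.2 (σ i)) ?_ ?_ ?_ ?_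
  · intro σ _
    simp only [Finset.mem_filter, Finset.mem_univ, true_and]
    ext x
    have := Finset.ext_iff.mp (Finset.image_orderEmbOfFin_univ S.1 S.2) x
    simp only [Finset.mem_image, Finset.mem_univ, true_and] at this ⊢
    rw [← this]
    exact ⟨fun ⟨i, hi⟩ => ⟨σ i, hi⟩, fun ⟨i, hi⟩ => ⟨σ.symm i, by simpa using hi⟩⟩
  · intro σ _ τ _ h
    ext i
    have := (S.1.orderEmbOfFin S.2).injective (congrFun h i)
    rw [this]
  · intro f hf
    simp only [Finset.mem_filter, Finset.mem_univ, true_and] at hf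
    have hmem : ∀ i, ∃ j, S.1.orderEmbOfFin S.2 j = f i := by
      intro i
      have : f i ∈ Set.range (S.1.orderEmbOfFin S.2) := by
        rw [Finset.range_orderEmbOfFin, ← hf]; simp
      exact this
    choose g hg using hmem
    have hinj : Function.Injective f := by
      have : (Finset.univ.image f).card = (Finset.univ : Finset (Fin m)).card := by
        rw [hf, S.2]; simp
      simpa using Finset.card_image_iff.mp this
    have hgi : Function.Injective g := fun a b hab => hinj (by rw [← hg, ← hg, hab])
    refine ⟨Equiv.ofBijective g (Finite.injective_iff_bijective.mp hgi), Finset.mem_univ _, ?_⟩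
    funext i
    simp [hg]
  · intro σ _; rfl

/-- Summing over `q` leaves a product of `2k` rotated operators. In its multilinear expansion the
sum over `X` keeps only the orderings of `S`; sorting them gives permutation signs and hence the
determinant. -/
theorem sum_xSign_parent {n k : ℕ} (hn : 0 < n) {O : Matrix (Fin (2 * n)) (Fin (2 * n)) ℝ}
    (hO : O ∈ Matrix.orthogonalGroup (Fin (2 * n)) ℝ) (T : ModeSet n k) (S : Label n (2 * k)) :
    ∑ q : Fin n → ℤˣ, ∑ X, ((xSign X S.1 : ℂ) * ∏ j ∈ T.1, (((q j : ℤˣ) : ℤ) : ℂ)) • parent O q X =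
      (minor O T.label S : ℂ) • monomial S.1 := by
  set R := T.label.1.orderEmbOfFin T.label.2 with hR
  have hinner : ∀ X, ∑ q : Fin n → ℤˣ,
      ((xSign X S.1 : ℂ) * ∏ j ∈ T.1, (((q j : ℤˣ) : ℤ) : ℂ)) • parent O q X =
      (((2 : ℂ) ^ (2 * n))⁻¹ * Complex.I ^ k) • ∑ f : Fin (2 * k) → Fin (2 * n),
        (∏ i, (O (R i) (f i) : ℂ)) • ((xSign X S.1 : ℂ) •
          conjBy X (List.ofFn (fun i => majorana (f i))).prod) := by
    intro X
    have e : ∀ q : Fin n → ℤˣ,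
        ((xSign X S.1 : ℂ) * ∏ j ∈ T.1, (((q j : ℤˣ) : ℤ) : ℂ)) • parent O q X =
        (((2 : ℂ) ^ (2 * n))⁻¹ * (xSign X S.1 : ℂ)) • conjBy X
          ((∏ j ∈ T.1, (((q j : ℤˣ) : ℤ) : ℂ)) • (List.ofFn (pairProj O q)).prod) := by
      intro q
      rw [parent_eq hn, map_smul, smul_smul, smul_smul]
      congr 1; ring
    simp only [e]
    rw [← Finset.smul_sum, ← map_sum, sum_pairProj, prod_pairObs hO]
    simp only [rotMajorana]
    rw [prod_ofFn_sum (fun i a => (O (R i) a : ℂ) • majorana a)]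
    simp only [prod_ofFn_smul]
    rw [map_smul, map_sum, smul_smul, Finset.smul_sum, Finset.smul_sum]
    refine Finset.sum_congr rfl fun f _ => ?_
    rw [map_smul, smul_smul, smul_smul, smul_smul]
    congr 1; ring
  rw [Finset.sum_comm]
  simp only [hinner]
  rw [← Finset.smul_sum, Finset.sum_comm]
  simp only [← Finset.smul_sum, sum_xSign_conjBy_word, smul_ite, smul_zero]
  rw [sum_image_eq_label S (fun f => (∏ i, (O (R i) (f i) : ℂ)) • ((2 : ℂ) ^ (2 * n) •
    (List.ofFn (fun i => majorana (f i))).prod))]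
  have hw : ∀ σ : Equiv.Perm (Fin (2 * k)),
      (List.ofFn (fun i => majorana (S.1.orderEmbOfFin S.2 (σ i)) : Fin (2 * k) → FockOp n)).prod =
      (((Equiv.Perm.sign σ : ℤˣ) : ℤ) : ℂ) •
        (List.ofFn (fun i => majorana (S.1.orderEmbOfFin S.2 i))).prod := by
    intro σ
    rw [prod_ofFn_perm σ (fun i => majorana (S.1.orderEmbOfFin S.2 i)), Int.cast_smul_eq_zsmul]
    intro i j hij
    exact majorana_anticomm (fun h => hij ((S.1.orderEmbOfFin S.2).injective h))
  simp only [hw, smul_smul, ← Finset.sum_smul]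
  rw [monomial_eq_ofFn S, smul_smul, I_pow_choose_two]
  congr 1
  have hdet : (minor O T.label S : ℂ) = ∑ σ : Equiv.Perm (Fin (2 * k)),
      (((Equiv.Perm.sign σ : ℤˣ) : ℤ) : ℂ) * ∏ i, (O (R i) (S.1.orderEmbOfFin S.2 (σ i)) : ℂ) := by
    rw [minor, ← Matrix.det_transpose, Matrix.det_apply']
    push_cast
    rfl
  rw [hdet, Finset.sum_mul, Finset.mul_sum]
  refine Finset.sum_congr rfl fun σ _ => ?_
  field_simp

theorem trace_mul_re_nonneg {ι : Type*} [Fintype ι] [DecidableEq ι] {A B : Matrix ι ι ℂ}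
    (hA : A.PosSemidef) (hB : B.PosSemidef) : 0 ≤ ((A * B).trace).re := by
  open scoped MatrixOrder in
  obtain ⟨C, rfl⟩ := CStarAlgebra.nonneg_iff_eq_star_mul_self.mp hA.nonneg
  rw [Matrix.star_eq_conjTranspose]
  rw [Matrix.mul_assoc, Matrix.trace_mul_comm]
  exact (Complex.le_def.mp (hB.mul_mul_conjTranspose_same C).trace_nonneg).1

theorem shotProb_nonneg {n N k : ℕ} {O : Fin N → Matrix (Fin (2 * n)) (Fin (2 * n)) ℝ}
    (hO : IsPOVM (jointMeasurement O)) {ρ : FockOp n} (hρ : IsState ρ) (ω : Shot n N k) :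
    0 ≤ shotProb k O ρ ω :=
  mul_nonneg (trace_mul_re_nonneg (hO.1 _) hρ.1) (by positivity)

theorem card_coins {ι : Type*} [Fintype ι] [DecidableEq ι] :
    ((Finset.univ : Finset (ι → ℤˣ)).card : ℝ) = 2 ^ Fintype.card ι := by
  rw [Finset.card_univ, Fintype.card_fun]
  simp

theorem sum_shotProb {n N k : ℕ} {O : Fin N → Matrix (Fin (2 * n)) (Fin (2 * n)) ℝ}
    (hO : IsPOVM (jointMeasurement O)) {ρ : FockOp n} (hρ : IsState ρ) :
    ∑ ω : Shot n N k, shotProb k O ρ ω = 1 := by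
  rw [Fintype.sum_prod_type]
  simp only [shotProb, Finset.sum_const, nsmul_eq_mul, card_coins]
  have h : ∀ x : ℝ, (2 : ℝ) ^ Fintype.card (Label n (2 * k)) *
      (x * ((2 : ℝ) ^ Fintype.card (Label n (2 * k)))⁻¹) = x := fun x => by field_simp
  simp only [h]
  rw [← Complex.re_sum, ← Matrix.trace_sum, ← Finset.sum_mul, hO.2, one_mul, hρ.2, Complex.one_re]

theorem sum_coin {ι : Type*} [Fintype ι] [DecidableEq ι] (S : ι) :
    ∑ c : ι → ℤˣ, (((c S : ℤˣ) : ℤ) : ℝ) = 0 := by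
  have := Equiv.sum_comp (Equiv.neg (ι → ℤˣ)) (fun c => (((c S : ℤˣ) : ℤ) : ℝ))
  simp only [Equiv.neg_apply, Pi.neg_apply, Units.val_neg, Int.cast_neg, Finset.sum_neg_distrib]
    at this
  linarith

/-- Measurement `r` has signed mean `sgn(μ) μ = |μ|` times the expectation value, where `μ` is its
minor. When `μ = 0` the fair coin has mean zero, consistent with this formula. -/
theorem sum_shotProb_outcomeSign {n N k : ℕ} (hn : 0 < n)
    {O : Fin N → Matrix (Fin (2 * n)) (Fin (2 * n)) ℝ}
    (hO : ∀ r, O r ∈ Matrix.orthogonalGroup (Fin (2 * n)) ℝ) (ρ : FockOp n)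
    (R : Fin N → Label n (2 * k) → ModeSet n k) (S : Label n (2 * k)) :
    ∑ ω, shotProb k O ρ ω * outcomeSign O R S ω = sharpness O R S * expectation S.1 ρ := by
  rw [Fintype.sum_prod_type, Fintype.sum_prod_type, sharpness, mul_assoc, Finset.sum_mul,
    Finset.mul_sum]
  refine Finset.sum_congr rfl fun r _ => ?_
  by_cases h : minor (O r) (R r S).label S = 0
  · simp only [shotProb, outcomeSign, h, if_true, ← Finset.mul_sum, sum_coin]
    simp
  · simp only [shotProb, outcomeSign, h, if_false, Finset.sum_const, nsmul_eq_mul, card_coins]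
    set μ := minor (O r) (R r S).label S
    have h1 : ∀ x y : ℝ, (2 : ℝ) ^ Fintype.card (Label n (2 * k)) *
      (x * ((2 : ℝ) ^ Fintype.card (Label n (2 * k)))⁻¹ * y) = x * y := fun x y => by field_simp
    simp only [h1]
    have h2 : ∀ (q : Fin n → ℤˣ) (X : Finset (Fin (2 * n))),
        ((jointMeasurement O (r, q, X) * ρ).trace).re *
          (Real.sign μ * xSign X S.1 * ∏ j ∈ (R r S).1, (((q j : ℤˣ) : ℤ) : ℝ)) =
        (N : ℝ)⁻¹ * Real.sign μ * (((((xSign X S.1 : ℂ) *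
          ∏ j ∈ (R r S).1, (((q j : ℤˣ) : ℤ) : ℂ)) • parent (O r) q X) * ρ).trace).re := by
      intro q X
      have e : (xSign X S.1 : ℂ) * ∏ j ∈ (R r S).1, (((q j : ℤˣ) : ℤ) : ℂ) =
          ((xSign X S.1 * ∏ j ∈ (R r S).1, (((q j : ℤˣ) : ℤ) : ℝ) : ℝ) : ℂ) := by push_cast; rfl
      have e2 : (N : ℂ)⁻¹ = (((N : ℝ)⁻¹ : ℝ) : ℂ) := by push_cast; rfl
      rw [e, jointMeasurement, e2, smul_mul_assoc, smul_mul_assoc, Matrix.trace_smul,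
        Matrix.trace_smul, smul_eq_mul, smul_eq_mul, Complex.re_ofReal_mul, Complex.re_ofReal_mul]
      ring
    rw [Fintype.sum_prod_type]
    simp only [h2, ← Finset.mul_sum, ← Complex.re_sum, ← Matrix.trace_sum, ← Finset.sum_mul]
    rw [sum_xSign_parent hn (hO r), smul_mul_assoc, Matrix.trace_smul, smul_eq_mul,
      Complex.re_ofReal_mul, mul_assoc, ← mul_assoc (Real.sign μ)]
    have h3 : Real.sign μ * μ = |μ| := by
      rcases lt_or_gt_of_ne h with h' | h'
      · rw [Real.sign_of_neg h', abs_of_neg h']; ring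
      · rw [Real.sign_of_pos h', abs_of_pos h']; ring
    rw [h3]
    rfl

theorem abs_outcomeSign {n N k : ℕ} (O : Fin N → Matrix (Fin (2 * n)) (Fin (2 * n)) ℝ)
    (R : Fin N → Label n (2 * k) → ModeSet n k) (S : Label n (2 * k)) (ω : Shot n N k) :
    |outcomeSign O R S ω| = 1 := by
  have hu : ∀ x : ℤˣ, |(((x : ℤˣ) : ℤ) : ℝ)| = 1 := fun x => by
    rcases Int.units_eq_one_or x with h | h <;> simp [h]
  unfold outcomeSign
  split_ifs with h
  · exact hu _
  · rw [abs_mul, abs_mul, Finset.abs_prod, xSign, abs_pow, abs_neg, abs_one, one_pow]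
    simp only [hu, Finset.prod_const_one, mul_one]
    rcases lt_or_gt_of_ne h with h' | h'
    · rw [Real.sign_of_neg h']; simp
    · rw [Real.sign_of_pos h']; simp

/-! ## Concentration for independent samples from a finite distribution -/

/-- The linear term drops out for a centered variable, leaving a subgaussian bound on its moment
generating function. -/
theorem exp_le_add_exp_sq (x : ℝ) : Real.exp x ≤ x + Real.exp (x ^ 2) := by
  have h1 := Real.add_one_le_exp (x ^ 2)
  rcases le_or_gt |x| 1 with h | h
  · have := Real.abs_exp_sub_one_sub_id_le h
    have := (abs_le.mp this).2
    linarith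
  · rcases lt_abs.mp h with h | h
    · have : Real.exp x ≤ Real.exp (x ^ 2) := Real.exp_le_exp.mpr (by nlinarith)
      linarith
    · have : Real.exp x ≤ 1 := Real.exp_le_one_iff.mpr (by linarith)
      nlinarith

theorem sum_mul_exp_le {Ω : Type} [Fintype Ω] {p : Ω → ℝ} (hp : ∀ ω, 0 ≤ p ω) (hsum : ∑ ω, p ω = 1)
    {Z : Ω → ℝ} (hmean : ∑ ω, p ω * Z ω = 0) {B : ℝ} (hB : ∀ ω, |Z ω| ≤ B) (t : ℝ) :
    ∑ ω, p ω * Real.exp (t * Z ω) ≤ Real.exp (t ^ 2 * B ^ 2) := by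
  calc ∑ ω, p ω * Real.exp (t * Z ω)
      ≤ ∑ ω, p ω * (t * Z ω + Real.exp (t ^ 2 * B ^ 2)) := by
        refine Finset.sum_le_sum fun ω _ => mul_le_mul_of_nonneg_left ?_ (hp ω)
        refine (exp_le_add_exp_sq _).trans (add_le_add le_rfl (Real.exp_le_exp.mpr ?_))
        rw [mul_pow]
        exact mul_le_mul_of_nonneg_left (sq_le_sq' (abs_le.mp (hB ω)).1 (abs_le.mp (hB ω)).2)
          (sq_nonneg t)
    _ = t * ∑ ω, p ω * Z ω + (∑ ω, p ω) * Real.exp (t ^ 2 * B ^ 2) := by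
        rw [Finset.mul_sum, Finset.sum_mul, ← Finset.sum_add_distrib]
        refine Finset.sum_congr rfl fun ω _ => ?_
        ring
    _ = _ := by rw [hmean, hsum]; ring

theorem sum_prod_exp_le {Ω : Type} [Fintype Ω] {p : Ω → ℝ} (hp : ∀ ω, 0 ≤ p ω)
    (hsum : ∑ ω, p ω = 1) {Z : Ω → ℝ} (hmean : ∑ ω, p ω * Z ω = 0) {B ε : ℝ} (hB0 : 0 < B)
    (hB : ∀ ω, |Z ω| ≤ B) (hε : 0 < ε) (L : ℕ) :
    ∑ ω : Fin L → Ω, (∏ j, p (ω j)) * Real.exp (ε / (2 * B ^ 2) * (∑ j, Z (ω j) - L * ε)) ≤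
      Real.exp (-(L * ε ^ 2 / (4 * B ^ 2))) := by
  -- The minimizer of `t² B² - t ε`.
  set t := ε / (2 * B ^ 2) with ht
  have h1 : ∀ ω : Fin L → Ω, (∏ j, p (ω j)) * Real.exp (t * (∑ j, Z (ω j) - L * ε)) =
      (∏ j, p (ω j) * Real.exp (t * Z (ω j))) * Real.exp (-(t * (L * ε))) := by
    intro ω
    rw [Finset.prod_mul_distrib, ← Real.exp_sum, mul_assoc, ← Real.exp_add, ← Finset.mul_sum]
    congr 2; ring
  simp only [h1]
  rw [← Finset.sum_mul, ← Fintype.sum_pow (fun ω => p ω * Real.exp (t * Z ω))]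
  have h2 : (∑ ω, p ω * Real.exp (t * Z ω)) ^ L ≤ Real.exp (t ^ 2 * B ^ 2) ^ L :=
    pow_le_pow_left₀ (Finset.sum_nonneg fun ω _ => mul_nonneg (hp ω) (Real.exp_pos _).le)
      (sum_mul_exp_le hp hsum hmean hB t) L
  refine (mul_le_mul_of_nonneg_right h2 (Real.exp_pos _).le).trans (le_of_eq ?_)
  rw [← Real.exp_nat_mul, ← Real.exp_add]
  congr 1
  rw [ht]
  field_simp
  ring

theorem iidProb_mono {Ω : Type} [Fintype Ω] {p : Ω → ℝ} (hp : ∀ ω, 0 ≤ p ω) {L : ℕ}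
    {E E' : Set (Fin L → Ω)} (h : E ⊆ E') : iidProb p L E ≤ iidProb p L E' := by
  unfold iidProb
  refine Finset.sum_le_sum fun ω _ => ?_
  have := Finset.prod_nonneg (s := Finset.univ) (fun j _ => hp (ω j))
  by_cases h1 : ω ∈ E
  · simp [h1, h h1]
  · simp only [h1, if_false]
    split_ifs <;> simp [this]

theorem iidProb_forall_abs_sum_lt {Ω ι : Type} [Fintype Ω] [Fintype ι] {p : Ω → ℝ}
    (hp : ∀ ω, 0 ≤ p ω) (hsum : ∑ ω, p ω = 1) {Z : ι → Ω → ℝ}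
    (hmean : ∀ s, ∑ ω, p ω * Z s ω = 0) {B ε : ℝ} (hB0 : 0 < B) (hB : ∀ s ω, |Z s ω| ≤ B)
    (hε : 0 < ε) (L : ℕ) :
    1 - 2 * Fintype.card ι * Real.exp (-(L * ε ^ 2 / (4 * B ^ 2))) ≤
      iidProb p L {ω | ∀ s, |∑ j, Z s (ω j)| < L * ε} := by
  set t := ε / (2 * B ^ 2) with ht
  have ht0 : 0 < t := by positivity
  set F : ι → (Fin L → Ω) → ℝ := fun s ω => Real.exp (t * (∑ j, Z s (ω j) - L * ε)) +
    Real.exp (t * (∑ j, - Z s (ω j) - L * ε))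
  have hW : ∑ ω : Fin L → Ω, ∏ j, p (ω j) = 1 := by
    rw [← Fintype.sum_pow p, hsum, one_pow]
  have hF : ∑ ω : Fin L → Ω, (∏ j, p (ω j)) * ∑ s, F s ω ≤
      2 * Fintype.card ι * Real.exp (-(L * ε ^ 2 / (4 * B ^ 2))) := by
    simp only [Finset.mul_sum]
    rw [Finset.sum_comm]
    have : ∀ s ∈ (Finset.univ : Finset ι), ∑ ω : Fin L → Ω, (∏ j, p (ω j)) * F s ω ≤
        2 * Real.exp (-(L * ε ^ 2 / (4 * B ^ 2))) := by
      intro s _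
      simp only [F, mul_add, Finset.sum_add_distrib]
      have a1 := sum_prod_exp_le hp hsum (hmean s) hB0 (hB s) hε L
      have a2 := sum_prod_exp_le hp hsum (Z := fun ω => - Z s ω)
        (by simp [hmean s]) hB0 (fun ω => by rw [abs_neg]; exact hB s ω) hε L
      linarith
    refine (Finset.sum_le_sum this).trans (le_of_eq ?_)
    rw [Finset.sum_const, Finset.card_univ, nsmul_eq_mul]; ring
  -- Markov's inequality and the union bound at once: `∑ s, F s` is nonnegative, and at least `1`
  -- wherever some deviation reaches `L ε`.
  have key : (∑ ω : Fin L → Ω, ∏ j, p (ω j)) - ∑ ω : Fin L → Ω, (∏ j, p (ω j)) * ∑ s, F s ω ≤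
      iidProb p L {ω | ∀ s, |∑ j, Z s (ω j)| < L * ε} := by
    unfold iidProb
    rw [← Finset.sum_sub_distrib]
    refine Finset.sum_le_sum fun ω _ => ?_
    have hw := Finset.prod_nonneg (s := Finset.univ) (fun j _ => hp (ω j))
    have hF0 : ∀ s, 0 ≤ F s ω := fun s => (add_pos (Real.exp_pos _) (Real.exp_pos _)).le
    split_ifs with h
    · exact sub_le_self _ (mul_nonneg hw (Finset.sum_nonneg fun s _ => hF0 s))
    · simp only [Set.mem_ofPred_eq, not_forall, not_lt] at h
      obtain ⟨s, hs⟩ := h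
      have h1 : 1 ≤ F s ω := by
        rcases le_abs.mp hs with h' | h'
        · have : 1 ≤ Real.exp (t * (∑ j, Z s (ω j) - L * ε)) :=
            Real.one_le_exp (mul_nonneg ht0.le (by linarith))
          exact this.trans (le_add_of_nonneg_right (Real.exp_pos _).le)
        · have : 1 ≤ Real.exp (t * (∑ j, - Z s (ω j) - L * ε)) :=
            Real.one_le_exp (mul_nonneg ht0.le (by rw [Finset.sum_neg_distrib]; linarith))
          exact this.trans (le_add_of_nonneg_left (Real.exp_pos _).le)
      have h2 : 1 ≤ ∑ s, F s ω :=
        h1.trans (Finset.single_le_sum (fun s _ => hF0 s) (Finset.mem_univ s))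
      nlinarith
  rw [hW] at key
  linarith

/-! ## Random permutations separate a small set -/

/-- By double transitivity of the symmetric group, `(π a, π b)` is uniform on pairs of distinct
elements. -/
theorem card_perm_pair {α : Type*} [Fintype α] [DecidableEq α] (P : α → α → Prop)
    [∀ x y, Decidable (P x y)] {a b : α} (hab : a ≠ b) :
    (Finset.univ.filter (fun π : Equiv.Perm α => P (π a) (π b))).card *
        (Finset.univ : Finset α).offDiag.card =
      Fintype.card (Equiv.Perm α) *
        ((Finset.univ : Finset α).offDiag.filter (fun z => P z.1 z.2)).card := by
  have hconst : ∀ z ∈ (Finset.univ : Finset α).offDiag,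
      (Finset.univ.filter (fun π : Equiv.Perm α => P (π z.1) (π z.2))).card =
        (Finset.univ.filter (fun π : Equiv.Perm α => P (π a) (π b))).card := by
    intro z hz
    have hz' : z.1 ≠ z.2 := by simpa using hz
    obtain ⟨σ, h1, h2⟩ : ∃ σ : Equiv.Perm α, σ a = z.1 ∧ σ b = z.2 :=
      (MulAction.is_two_pretransitive_iff (G := Equiv.Perm α) (α := α)).mp
        (Equiv.Perm.isMultiplyPretransitive α 2) hab hz'
    refine Finset.card_bij' (fun π _ => π * σ) (fun π _ => π * σ⁻¹) ?_ ?_ ?_ ?_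
    · intro π hπ; simpa [h1, h2] using hπ
    · intro π hπ
      have e1 : σ.symm z.1 = a := by rw [← h1]; simp
      have e2 : σ.symm z.2 = b := by rw [← h2]; simp
      simpa [e1, e2] using hπ
    · intro π _; simp
    · intro π _; simp
  have h1 : ∑ z ∈ (Finset.univ : Finset α).offDiag,
      (Finset.univ.filter (fun π : Equiv.Perm α => P (π z.1) (π z.2))).card =
      (Finset.univ.filter (fun π : Equiv.Perm α => P (π a) (π b))).card *
        (Finset.univ : Finset α).offDiag.card := by
    rw [Finset.sum_congr rfl hconst, Finset.sum_const, smul_eq_mul, mul_comm]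
  rw [← h1]
  simp only [Finset.card_filter]
  rw [Finset.sum_comm, ← Finset.card_univ, ← smul_eq_mul, ← Finset.sum_const]
  refine Finset.sum_congr rfl fun π _ => ?_
  refine Finset.sum_bij' (fun z _ => (π z.1, π z.2)) (fun z _ => (π⁻¹ z.1, π⁻¹ z.2)) ?_ ?_ ?_ ?_ ?_ <;>
    simp

theorem card_perm_single {α : Type*} [Fintype α] [DecidableEq α] (P : α → Prop) [DecidablePred P]
    (a : α) :
    (Finset.univ.filter (fun π : Equiv.Perm α => P (π a))).card * Fintype.card α =
      Fintype.card (Equiv.Perm α) * (Finset.univ.filter P).card := by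
  have hconst : ∀ z ∈ (Finset.univ : Finset α),
      (Finset.univ.filter (fun π : Equiv.Perm α => P (π z))).card =
        (Finset.univ.filter (fun π : Equiv.Perm α => P (π a))).card := by
    intro z _
    refine Finset.card_bij' (fun π _ => π * Equiv.swap a z) (fun π _ => π * Equiv.swap a z)
      ?_ ?_ ?_ ?_
    · intro π hπ; simpa using hπ
    · intro π hπ; simpa using hπ
    · intro π _; simp [mul_assoc]
    · intro π _; simp [mul_assoc]
  have h1 : ∑ z : α, (Finset.univ.filter (fun π : Equiv.Perm α => P (π z))).card =
      (Finset.univ.filter (fun π : Equiv.Perm α => P (π a))).card * Fintype.card α := by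
    rw [Finset.sum_congr rfl hconst, Finset.sum_const, smul_eq_mul, mul_comm, Finset.card_univ]
  rw [← h1]
  simp only [Finset.card_filter]
  rw [Finset.sum_comm, ← Finset.card_univ, ← smul_eq_mul, ← Finset.sum_const]
  exact Finset.sum_congr rfl fun π _ => Equiv.sum_comp π (fun x => if P x then 1 else 0)

/-- The elements of `S` lie in pairwise different proper blocks after the permutation `π`. -/
def Separates {α β : Type*} (blk : α → Option β) (π : Equiv.Perm α) (S : Finset α) : Prop :=
  (∀ a ∈ S, blk (π a) ≠ none) ∧ ∀ a ∈ S, ∀ b ∈ S, blk (π a) = blk (π b) → a = b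

open Classical in
-- Union bound over `|S|` events of landing in the leftover block `none` and `|S|² - |S|` collisions
-- of ordered pairs, each of probability at most `m / |α|`.
theorem card_not_separates {α β : Type*} [Fintype α] (blk : α → Option β) (m : ℕ)
    (hm : ∀ c, (Finset.univ.filter (fun x => blk x = c)).card ≤ m) (S : Finset α) :
    (Finset.univ.filter (fun π : Equiv.Perm α => ¬ Separates blk π S)).card * Fintype.card α ≤
      Fintype.card (Equiv.Perm α) * (m * S.card ^ 2) := by
  set F := Fintype.card (Equiv.Perm α)
  obtain ⟨D, hD⟩ : ∃ D, D = Fintype.card α := ⟨_, rfl⟩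
  rw [← hD]
  have hsub : Finset.univ.filter (fun π : Equiv.Perm α => ¬ Separates blk π S) ⊆
      (S.biUnion fun a => Finset.univ.filter (fun π : Equiv.Perm α => blk (π a) = none)) ∪
      (S.offDiag.biUnion fun z =>
        Finset.univ.filter (fun π : Equiv.Perm α => blk (π z.1) = blk (π z.2))) := by
    intro π hπ
    simp only [Finset.mem_filter, Finset.mem_univ, true_and, Separates, not_and_or] at hπ
    simp only [Finset.mem_union, Finset.mem_biUnion, Finset.mem_filter, Finset.mem_univ, true_and,
      Finset.mem_offDiag]
    rcases hπ with h | h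
    · push Not at h; exact Or.inl h
    · push Not at h
      obtain ⟨a, ha, b, hb, h1, h2⟩ := h
      exact Or.inr ⟨(a, b), ⟨ha, hb, h2⟩, h1⟩
  have h1 : ∀ a ∈ S, (Finset.univ.filter (fun π : Equiv.Perm α => blk (π a) = none)).card * D ≤
      F * m := by
    intro a _
    rw [hD, card_perm_single (fun x => blk x = none) a]
    exact Nat.mul_le_mul_left _ (hm none)
  have h2 : ∀ z ∈ S.offDiag,
      (Finset.univ.filter (fun π : Equiv.Perm α => blk (π z.1) = blk (π z.2))).card * D ≤
      F * m := by
    rintro ⟨a, b⟩ hz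
    have hab : a ≠ b := (Finset.mem_offDiag.mp hz).2.2
    have hD2 : 2 ≤ D := by
      have := Fintype.one_lt_card_iff.mpr ⟨a, b, hab⟩
      omega
    have hp := card_perm_pair (fun x y => blk x = blk y) hab
    set N := (Finset.univ.filter (fun π : Equiv.Perm α => blk (π a) = blk (π b))).card
    have hN : N ≤ F := Finset.card_le_univ _
    have hm1 : 1 ≤ m := by
      refine le_trans ?_ (hm (blk a))
      exact Finset.card_pos.mpr ⟨a, by simp⟩
    have hoff : ((Finset.univ : Finset α).offDiag.filter (fun z => blk z.1 = blk z.2)).card ≤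
        D * (m - 1) := by
      have : (Finset.univ : Finset α).offDiag.filter (fun z => blk z.1 = blk z.2) ⊆
          (Finset.univ : Finset α).biUnion (fun x =>
            ((Finset.univ.filter (fun y => blk y = blk x)).erase x).image (fun y => (x, y))) := by
        rintro ⟨x, y⟩ h
        simp only [Finset.mem_filter, Finset.mem_offDiag, Finset.mem_univ, true_and] at h
        simp only [Finset.mem_biUnion, Finset.mem_univ, true_and, Finset.mem_image,
          Finset.mem_erase, Finset.mem_filter]
        exact ⟨x, y, ⟨Ne.symm h.1, h.2.symm⟩, rfl⟩
      refine (Finset.card_le_card this).trans (Finset.card_biUnion_le.trans ?_)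
      rw [hD, ← Finset.card_univ, ← smul_eq_mul, ← Finset.sum_const]
      refine Finset.sum_le_sum fun x _ => Finset.card_image_le.trans ?_
      rw [Finset.card_erase_of_mem (by simp)]
      exact Nat.sub_le_sub_right (hm _) 1
    rw [Finset.offDiag_card, Finset.card_univ, ← hD] at hp
    obtain ⟨d, rfl⟩ : ∃ d, D = d + 2 := ⟨D - 2, by omega⟩
    obtain ⟨l, rfl⟩ : ∃ l, m = l + 1 := ⟨m - 1, by omega⟩
    have e : (d + 2) * (d + 2) - (d + 2) = (d + 2) * (d + 1) := by
      rw [Nat.sub_eq_iff_eq_add (Nat.le_mul_self _)]; ring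
    rw [e] at hp
    rw [Nat.add_sub_cancel] at hoff
    have h3 : (d + 2) * (N * (d + 1)) ≤ (d + 2) * (F * l) := by
      calc (d + 2) * (N * (d + 1)) = N * ((d + 2) * (d + 1)) := by ring
        _ = _ := hp
        _ ≤ F * ((d + 2) * l) := Nat.mul_le_mul_left _ hoff
        _ = _ := by ring
    -- The collision probability is at most `(m - 1)/(D - 1)`; together with `N ≤ F` this improves
    -- to `m / D`.
    have h4 := Nat.le_of_mul_le_mul_left h3 (by omega)
    change N * (d + 2) ≤ F * (l + 1)
    nlinarith
  refine (Nat.mul_le_mul_right _ ((Finset.card_le_card hsub).trans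
    ((Finset.card_union_le _ _).trans (add_le_add Finset.card_biUnion_le
      Finset.card_biUnion_le)))).trans ?_
  rw [add_mul, Finset.sum_mul, Finset.sum_mul]
  refine (add_le_add (Finset.sum_le_sum h1) (Finset.sum_le_sum h2)).trans (le_of_eq ?_)
  rw [Finset.sum_const, Finset.sum_const, smul_eq_mul, smul_eq_mul, Finset.offDiag_card]
  obtain ⟨c, hc⟩ : ∃ c, S.card * S.card = S.card + c := ⟨_, (Nat.add_sub_of_le (Nat.le_mul_self _)).symm⟩
  rw [sq, hc, Nat.add_sub_cancel_left]; ring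

open Classical in
/-- If every element is missed by at most a fraction `p` of the choices, then some `M` choices
together miss at most a fraction `p ^ M` of the elements. -/
theorem exists_choices {Γ Λ : Type*} [Fintype Γ] [Nonempty Γ] [Fintype Λ] (bad : Γ → Λ → Prop)
    {p : ℝ} (hp : 0 ≤ p)
    (h : ∀ S, ((Finset.univ.filter (fun g => bad g S)).card : ℝ) ≤ p * Fintype.card Γ) (M : ℕ) :
    ∃ g : Fin M → Γ, ((Finset.univ.filter (fun S => ∀ i, bad (g i) S)).card : ℝ) ≤
      p ^ M * Fintype.card Λ := by
  induction M with
  | zero => exact ⟨Fin.elim0, by simp [Finset.card_univ]⟩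
  | succ M ih =>
    obtain ⟨g, hg⟩ := ih
    set B := Finset.univ.filter (fun S => ∀ i, bad (g i) S)
    -- By double counting, an average choice misses at most a fraction `p` of the elements still
    -- uncovered.
    have hsum : ∑ x : Γ, ((B.filter (fun S => bad x S)).card : ℝ) ≤ ∑ _x : Γ, p * B.card := by
      have e : ∑ x : Γ, ((B.filter (fun S => bad x S)).card : ℝ) =
          ∑ S ∈ B, ((Finset.univ.filter (fun x => bad x S)).card : ℝ) := by
        simp only [Finset.card_filter, Nat.cast_sum]
        rw [Finset.sum_comm]
      rw [e]
      refine (Finset.sum_le_sum fun S _ => h S).trans (le_of_eq ?_)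
      rw [Finset.sum_const, Finset.sum_const, Finset.card_univ, nsmul_eq_mul, nsmul_eq_mul]; ring
    obtain ⟨x, _, hx⟩ := Finset.exists_le_of_sum_le Finset.univ_nonempty hsum
    refine ⟨Fin.snoc g x, ?_⟩
    have hset : Finset.univ.filter (fun S => ∀ i, bad (Fin.snoc (α := fun _ => Γ) g x i) S) =
        B.filter (fun S => bad x S) := by
      ext S
      simp [B, Fin.forall_fin_succ', Finset.mem_filter]
    rw [hset]
    refine hx.trans ?_
    rw [pow_succ, mul_comm (p ^ M), mul_assoc]
    exact mul_le_mul_of_nonneg_left hg hp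

open Classical in
theorem exists_choices_cover {Γ Λ : Type*} [Fintype Γ] [Nonempty Γ] [Fintype Λ]
    (bad : Γ → Λ → Prop) {p : ℝ} (hp : 0 ≤ p)
    (h : ∀ S, ((Finset.univ.filter (fun g => bad g S)).card : ℝ) ≤ p * Fintype.card Γ) (M : ℕ)
    (hM : p ^ M * Fintype.card Λ < 1) :
    ∃ g : Fin M → Γ, ∀ S, ∃ i, ¬ bad (g i) S := by
  obtain ⟨g, hg⟩ := exists_choices bad hp h M
  refine ⟨g, fun S => ?_⟩
  by_contra! hc
  have h0 := Nat.cast_lt_one.mp (hg.trans_lt hM)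
  rw [Finset.card_eq_zero, Finset.filter_eq_empty_iff] at h0
  exact h0 (Finset.mem_univ S) hc

/-- A few permutations suffice for every set of `s` elements to be separated by one of them. -/
theorem exists_separating_perms {α β : Type*} [Fintype α] [Nonempty α] (blk : α → Option β) (m : ℕ)
    (hm : ∀ c, Nat.card {x // blk x = c} ≤ m) (s M : ℕ)
    (hM : ((m : ℝ) * (s : ℝ) ^ 2 / Fintype.card α) ^ M * (Fintype.card α).choose s < 1) :
    ∃ g : Fin M → Equiv.Perm α, ∀ S : Finset α, S.card = s → ∃ i, Separates blk (g i) S := by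
  classical
  have hD : (0 : ℝ) < Fintype.card α := by exact_mod_cast Fintype.card_pos
  rw [← Fintype.card_finset_len] at hM
  obtain ⟨g, hg⟩ := exists_choices_cover
    (fun (π : Equiv.Perm α) (S : {S : Finset α // S.card = s}) => ¬ Separates blk π S.1)
    (by positivity)
    (fun S => by
      have h := card_not_separates blk m (fun c => by
        have := hm c
        rwa [Nat.card_eq_fintype_card, Fintype.card_subtype] at this) S.1
      rw [S.2] at h
      rw [div_mul_eq_mul_div, le_div_iff₀ hD, mul_comm (_ * _) (Fintype.card (Equiv.Perm α) : ℝ)]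
      refine le_trans (le_of_eq ?_) ((Nat.cast_le (α := ℝ)).mpr h |>.trans (le_of_eq ?_))
      · rw [Nat.cast_mul]
        congr!
      · push_cast; rfl) M hM
  exact ⟨g, fun S hS => (hg ⟨S, hS⟩).imp fun i hi => not_not.mp hi⟩

/-! ## A block matrix with flat rows -/

/-- Sylvester's doubling of Hadamard matrices. -/
theorem exists_flat_orthogonal (t : ℕ) : ∃ H : Matrix (Fin (2 ^ t)) (Fin (2 ^ t)) ℝ,
    H * H.transpose = ((2 : ℝ) ^ t) • (1 : Matrix (Fin (2 ^ t)) (Fin (2 ^ t)) ℝ) ∧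
      ∀ i j, |H i j| = 1 := by
  induction t with
  | zero =>
    refine ⟨Matrix.of fun _ _ => 1, ?_, fun _ _ => by simp⟩
    ext i j
    have : Subsingleton (Fin (2 ^ 0)) := by rw [pow_zero]; infer_instance
    rw [Subsingleton.elim i j]
    simp [Matrix.mul_apply]
  | succ t ih =>
    obtain ⟨H, h1, h2⟩ := ih
    have e : Fin (2 ^ (t + 1)) ≃ Fin (2 ^ t) ⊕ Fin (2 ^ t) :=
      Fintype.equivOfCardEq (by simp; ring)
    refine ⟨(Matrix.fromBlocks H H H (-H)).submatrix e e, ?_, ?_⟩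
    · rw [Matrix.transpose_submatrix, Matrix.submatrix_mul_equiv, Matrix.fromBlocks_transpose,
        Matrix.fromBlocks_multiply]
      have h3 : Matrix.fromBlocks (H * H.transpose + H * H.transpose)
          (H * H.transpose + H * (-H).transpose) (H * H.transpose + -H * H.transpose)
          (H * H.transpose + -H * (-H).transpose) =
          ((2 : ℝ) ^ (t + 1)) • (1 : Matrix (Fin (2 ^ t) ⊕ Fin (2 ^ t)) _ ℝ) := by
        rw [← Matrix.fromBlocks_one, Matrix.fromBlocks_smul]
        congr 1
        · rw [h1, ← add_smul]; congr 1; ring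
        · simp
        · simp
        · simp only [Matrix.transpose_neg, Matrix.neg_mul, Matrix.mul_neg, neg_neg]
          rw [h1, ← add_smul]; congr 1; ring
      rw [h3]
      ext i j
      simp [Matrix.one_apply]
    · intro i j
      rw [Matrix.submatrix_apply]
      rcases e i with a | a <;> rcases e j with b | b <;> simp [h2]

/-- The matrix consists of `q` scaled copies of `H` and an identity on the leftover coordinates,
with block label `none`. Row `P i j` belongs to block `i` and is reserved for its link with block
`j`: it shares a mode with `P j i`. Only `i ≠ j` carries meaning. -/
theorem exists_block_matrix {n m q : ℕ} (hmpos : 0 < m) (hq : q * m ≤ 2 * n)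
    (hrest : 2 * n < q * m + m) (h2q : 2 * q ≤ m) {H : Matrix (Fin m) (Fin m) ℝ}
    (hH : H * H.transpose = (m : ℝ) • (1 : Matrix (Fin m) (Fin m) ℝ)) (hHabs : ∀ i j, |H i j| = 1) :
    ∃ (B : Matrix (Fin (2 * n)) (Fin (2 * n)) ℝ) (blk : Fin (2 * n) → Option (Fin q))
      (P : Fin q → Fin q → Fin (2 * n)),
      B * B.transpose = 1 ∧
      (∀ c, (Finset.univ.filter (fun x => blk x = c)).card ≤ m) ∧
      (∀ i j i' j', i ≠ j → i' ≠ j' → P i j = P i' j' → i = i') ∧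
      (∀ i j, i ≠ j → modeOf (P i j) = modeOf (P j i)) ∧
      (∀ i j x c, i ≠ j → blk x = some c → c ≠ i → B (P i j) x = 0) ∧
      (∀ i j x, i ≠ j → blk x = some i → |B (P i j) x| = (√m)⁻¹) := by
  set rest := 2 * n - q * m
  -- From `2q² ≤ qm ≤ 2n`; there is thus room for the mode numbers `i q + j`.
  have hqn : q * q ≤ n := by nlinarith
  set w : ℝ := (√m)⁻¹ with hw
  have hw2 : w * w * m = 1 := by
    rw [hw, ← mul_inv, Real.mul_self_sqrt (by positivity), inv_mul_cancel₀ (by positivity)]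
  let M : Matrix ((Fin m × Fin q) ⊕ Fin rest) ((Fin m × Fin q) ⊕ Fin rest) ℝ :=
    Matrix.fromBlocks (Matrix.blockDiagonal (fun _ : Fin q => w • H)) 0 0 1
  have hM : M * M.transpose = 1 := by
    have hb : (w • H) * (w • H).transpose = 1 := by
      rw [Matrix.transpose_smul, Matrix.smul_mul, Matrix.mul_smul, smul_smul, hH, smul_smul, hw2,
        one_smul]
    have hd : Matrix.blockDiagonal (fun _ : Fin q => w • H) *
        (Matrix.blockDiagonal (fun _ : Fin q => w • H)).transpose = 1 := by
      rw [Matrix.blockDiagonal_transpose, ← Matrix.blockDiagonal_mul]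
      simp only [hb]
      exact Matrix.blockDiagonal_one
    simp only [M]
    rw [Matrix.fromBlocks_transpose, Matrix.fromBlocks_multiply, hd]
    simp
  have hcard : Fintype.card ((Fin m × Fin q) ⊕ Fin rest) = 2 * n := by
    simp only [Fintype.card_sum, Fintype.card_prod, Fintype.card_fin, rest]
    rw [mul_comm m q]; omega
  let ec : Fin (2 * n) ≃ (Fin m × Fin q) ⊕ Fin rest :=
    Fintype.equivOfCardEq (by rw [hcard, Fintype.card_fin])
  let blkI : (Fin m × Fin q) ⊕ Fin rest → Option (Fin q) := Sum.elim (fun z => some z.2) (fun _ => none)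
  have hφ : ∀ i j : Fin q, i.val * q + j.val < n := by
    intro i j
    have h1 : i.val * q + q ≤ q * q := by
      have := Nat.mul_le_mul_right q (Nat.succ_le_of_lt i.2)
      rw [Nat.succ_mul] at this; exact this
    have := j.2
    omega
  let φ : Fin q → Fin q → Fin n := fun i j => ⟨i.val * q + j.val, hφ i j⟩
  have hφinj : ∀ i j i' j', φ i j = φ i' j' → i = i' ∧ j = j' := by
    intro i j i' j' h
    simp only [φ, Fin.mk.injEq] at h
    have hq0 : 0 < q := i.pos
    have e1 := congrArg (· / q) h
    have e2 := congrArg (· % q) h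
    simp only [Nat.mul_comm _ q, Nat.mul_add_div hq0, Nat.div_eq_of_lt j.2, Nat.div_eq_of_lt j'.2,
      Nat.mul_add_mod, Nat.mod_eq_of_lt j.2, Nat.mod_eq_of_lt j'.2, add_zero] at e1 e2
    exact ⟨Fin.ext e1, Fin.ext e2⟩
  let P : Fin q → Fin q → Fin (2 * n) := fun i j => if i < j then loLabel (φ i j) else hiLabel (φ j i)
  have hlo : ∀ a b : Fin n, loLabel a = loLabel b → a = b := fun a b h => by
    simp only [loLabel, Fin.mk.injEq] at h; exact Fin.ext (by omega)
  have hhi : ∀ a b : Fin n, hiLabel a = hiLabel b → a = b := fun a b h => by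
    simp only [hiLabel, Fin.mk.injEq] at h; exact Fin.ext (by omega)
  have hlh : ∀ a b : Fin n, loLabel a ≠ hiLabel b := fun a b h => by
    simp only [loLabel, hiLabel, Fin.mk.injEq] at h; omega
  have hPinj : ∀ i j i' j', i ≠ j → i' ≠ j' → P i j = P i' j' → i = i' ∧ j = j' := by
    intro i j i' j' _ _ h
    simp only [P] at h
    split_ifs at h with h1 h2 h2
    · exact hφinj _ _ _ _ (hlo _ _ h)
    · exact absurd h (hlh _ _)
    · exact absurd h.symm (hlh _ _)
    · exact (hφinj _ _ _ _ (hhi _ _ h)).symm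
  have hqm : q ≤ m := by omega
  -- The row positions are prescribed only at the linking rows; this injection extends to a
  -- bijection, so the other values of `F` below are irrelevant.
  obtain ⟨er, her⟩ : ∃ er : Fin (2 * n) ≃ (Fin m × Fin q) ⊕ Fin rest,
      ∀ i j, i ≠ j → er (P i j) = Sum.inl (Fin.castLE hqm j, i) := by
    rcases Nat.eq_zero_or_pos q with h0 | h0
    · refine ⟨ec, fun i => ?_⟩
      subst h0; exact i.elim0
    let F : (Fin m × Fin q) ⊕ Fin rest → Fin (2 * n) :=
      Sum.elim (fun z => if h : z.1.val < q then P z.2 ⟨z.1.val, h⟩ else P z.2 z.2)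
        (fun _ => P ⟨0, h0⟩ ⟨0, h0⟩)
    have hF : ∀ i j, F (Sum.inl (Fin.castLE hqm j, i)) = P i j := by
      intro i j
      simp [F]
    let s : Finset ((Fin m × Fin q) ⊕ Fin rest) :=
      ((Finset.univ : Finset (Fin q × Fin q)).filter (fun z => z.1 ≠ z.2)).image
        (fun z => Sum.inl (Fin.castLE hqm z.2, z.1))
    obtain ⟨g, hg⟩ := Finset.exists_equiv_extend_of_card_eq (t := (Finset.univ : Finset (Fin (2 * n))))
      (by rw [hcard, Finset.card_univ, Fintype.card_fin]) (s := s) (f := F)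
      (Finset.subset_univ _) (by
        intro a ha b hb hab
        simp only [s, Finset.coe_image, Finset.coe_filter, Finset.mem_univ, true_and,
          Set.mem_image] at ha hb
        obtain ⟨z, hz, rfl⟩ := ha
        obtain ⟨z', hz', rfl⟩ := hb
        rw [hF, hF] at hab
        obtain ⟨h1, h2⟩ := hPinj _ _ _ _ hz hz' hab
        rw [h1, h2])
    refine ⟨(g.trans (Equiv.subtypeUnivEquiv (fun x => Finset.mem_univ x))).symm, fun i j hij => ?_⟩
    rw [Equiv.symm_apply_eq]
    have := hg (Sum.inl (Fin.castLE hqm j, i)) (Finset.mem_image.mpr ⟨(i, j), by simpa using hij, rfl⟩)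
    rw [hF] at this
    exact this.symm
  refine ⟨M.submatrix er ec, blkI ∘ ec, P, ?_, ?_, ?_, ?_, ?_, ?_⟩
  · rw [Matrix.transpose_submatrix, Matrix.submatrix_mul_equiv, hM, Matrix.submatrix_one_equiv]
  · intro c
    cases c with
    | none =>
      have : Finset.univ.filter (fun x => (blkI ∘ ec) x = none) ⊆
          (Finset.univ : Finset (Fin rest)).image (fun y => ec.symm (Sum.inr y)) := by
        intro x hx
        simp only [Finset.mem_filter, Finset.mem_univ, true_and, Function.comp_apply] at hx
        simp only [Finset.mem_image, Finset.mem_univ, true_and]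
        rcases h : ec x with z | y
        · rw [h] at hx; simp [blkI] at hx
        · exact ⟨y, by rw [← h, Equiv.symm_apply_apply]⟩
      refine (Finset.card_le_card this).trans (Finset.card_image_le.trans ?_)
      rw [Finset.card_univ, Fintype.card_fin]
      simp only [rest]; omega
    | some i =>
      have : Finset.univ.filter (fun x => (blkI ∘ ec) x = some i) ⊆
          (Finset.univ : Finset (Fin m)).image (fun y => ec.symm (Sum.inl (y, i))) := by
        intro x hx
        simp only [Finset.mem_filter, Finset.mem_univ, true_and, Function.comp_apply] at hx
        simp only [Finset.mem_image, Finset.mem_univ, true_and]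
        rcases h : ec x with ⟨y, i'⟩ | y
        · rw [h] at hx
          simp only [blkI, Sum.elim_inl, Option.some.injEq] at hx
          exact ⟨y, by rw [← hx, ← h, Equiv.symm_apply_apply]⟩
        · rw [h] at hx; simp [blkI] at hx
      refine (Finset.card_le_card this).trans (Finset.card_image_le.trans ?_)
      rw [Finset.card_univ, Fintype.card_fin]
  · intro i j i' j' h1 h2 h
    exact (hPinj _ _ _ _ h1 h2 h).1
  · intro i j hij
    have ml : ∀ a : Fin n, modeOf (loLabel a) = a := fun a => Fin.ext (by simp [modeOf, loLabel])
    have mh : ∀ a : Fin n, modeOf (hiLabel a) = a := fun a =>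
      Fin.ext (by simp only [modeOf, hiLabel]; omega)
    simp only [P]
    rcases lt_or_gt_of_ne hij with h | h
    · rw [if_pos h, if_neg h.not_gt, ml, mh]
    · rw [if_neg h.not_gt, if_pos h, ml, mh]
  · intro i j x c hij hx hc
    rw [Matrix.submatrix_apply, her i j hij]
    simp only [Function.comp_apply] at hx
    rcases h : ec x with ⟨y, i'⟩ | y
    · rw [h] at hx
      simp only [blkI, Sum.elim_inl, Option.some.injEq] at hx
      simp only [M, Matrix.fromBlocks_apply₁₁, Matrix.blockDiagonal_apply]
      rw [if_neg (by rw [hx]; exact hc.symm)]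
    · rw [h] at hx; simp [blkI] at hx
  · intro i j x hij hx
    rw [Matrix.submatrix_apply, her i j hij]
    simp only [Function.comp_apply] at hx
    rcases h : ec x with ⟨y, i'⟩ | y
    · rw [h] at hx
      simp only [blkI, Sum.elim_inl, Option.some.injEq] at hx
      simp only [M, Matrix.fromBlocks_apply₁₁, Matrix.blockDiagonal_apply]
      rw [if_pos hx.symm, Matrix.smul_apply, smul_eq_mul, abs_mul, hHabs, mul_one,
        abs_of_nonneg (by positivity)]
    · rw [h] at hx; simp [blkI] at hx

theorem abs_minor_eq_abs_det {n m : ℕ} (O : Matrix (Fin (2 * n)) (Fin (2 * n)) ℝ) (R S : Label n m)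
    {g : Fin m → Fin (2 * n)} (hg : Function.Injective g) (hR : ∀ i, g i ∈ R.1) :
    |minor O R S| = |(O.submatrix g (S.1.orderEmbOfFin S.2)).det| := by
  have hmem : ∀ i, ∃ j, R.1.orderEmbOfFin R.2 j = g i := by
    intro i
    have : g i ∈ Set.range (R.1.orderEmbOfFin R.2) := by
      rw [Finset.range_orderEmbOfFin]; exact hR i
    exact this
  choose f hf using hmem
  have hfi : Function.Injective f := fun a b hab => hg (by rw [← hf, ← hf, hab])
  let σ : Equiv.Perm (Fin m) := Equiv.ofBijective f (Finite.injective_iff_bijective.mp hfi)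
  have e : O.submatrix g (S.1.orderEmbOfFin S.2) =
      (O.submatrix (R.1.orderEmbOfFin R.2) (S.1.orderEmbOfFin S.2)).submatrix σ id := by
    ext i j
    simp [σ, hf]
  rw [e, Matrix.det_permute, abs_mul, minor]
  rcases Int.units_eq_one_or (Equiv.Perm.sign σ) with h | h <;> simp [h]

/-- The blocks met by `S` are distinct, so pair them up consecutively and use the modes linking
partners. Each chosen row vanishes on the columns in the other blocks, so the submatrix is diagonal
in a suitable row order. -/
theorem exists_large_minor {n q k : ℕ} {B : Matrix (Fin (2 * n)) (Fin (2 * n)) ℝ}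
    {blk : Fin (2 * n) → Option (Fin q)} {P : Fin q → Fin q → Fin (2 * n)} {w : ℝ}
    (hP : ∀ i j i' j', i ≠ j → i' ≠ j' → P i j = P i' j' → i = i')
    (hmode : ∀ i j, i ≠ j → modeOf (P i j) = modeOf (P j i))
    (hzero : ∀ i j x c, i ≠ j → blk x = some c → c ≠ i → B (P i j) x = 0)
    (hflat : ∀ i j x, i ≠ j → blk x = some i → |B (P i j) x| = w)
    (π : Equiv.Perm (Fin (2 * n))) (S : Label n (2 * k)) (hS : Separates blk π S.1) :
    ∃ T : ModeSet n k, |minor (B.submatrix id π) T.label S| = w ^ (2 * k) := by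
  set s := S.1.orderEmbOfFin S.2
  have hsm : ∀ x, s x ∈ S.1 := fun x => S.1.orderEmbOfFin_mem S.2 x
  have hb : ∀ x, ∃ c, blk (π (s x)) = some c := fun x =>
    Option.ne_none_iff_exists'.mp (hS.1 _ (hsm x))
  choose b hb using hb
  have hbi : Function.Injective b := by
    intro x y hxy
    apply s.injective
    exact hS.2 _ (hsm x) _ (hsm y) (by rw [hb, hb, hxy])
  let par : Fin (2 * k) → Fin (2 * k) := fun x =>
    if h : x.val % 2 = 0 then ⟨x.val + 1, by omega⟩ else ⟨x.val - 1, by omega⟩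
  have hval : ∀ x, (par x).val = if x.val % 2 = 0 then x.val + 1 else x.val - 1 := by
    intro x
    simp only [par]
    split_ifs <;> rfl
  have hpar : ∀ x, par x ≠ x := by
    intro x h
    have := hval x
    rw [h] at this
    split_ifs at this <;> omega
  have hparpar : ∀ x, par (par x) = x := by
    intro x
    ext
    rw [hval, hval]
    split_ifs <;> omega
  let g : Fin (2 * k) → Fin (2 * n) := fun x => P (b x) (b (par x))
  have hne : ∀ x, b x ≠ b (par x) := fun x h => hpar x (hbi h).symm
  have hgi : Function.Injective g := fun x y h => hbi (hP _ _ _ _ (hne x) (hne y) h)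
  have hgm : ∀ x, modeOf (g (par x)) = modeOf (g x) := by
    intro x
    simp only [g, hparpar]
    exact hmode _ _ (hne x).symm
  let T : Finset (Fin n) := Finset.univ.image (fun x => modeOf (g x))
  have hle : T.card ≤ k := by
    have : T ⊆ (Finset.univ : Finset (Fin k)).image (fun y => modeOf (g ⟨2 * y.val, by omega⟩)) := by
      intro z hz
      simp only [T, Finset.mem_image, Finset.mem_univ, true_and] at hz ⊢
      obtain ⟨x, rfl⟩ := hz
      refine ⟨⟨x.val / 2, by omega⟩, ?_⟩
      rcases Nat.mod_two_eq_zero_or_one x.val with h | h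
      · have e : (⟨2 * (x.val / 2), by omega⟩ : Fin (2 * k)) = x := Fin.ext (by simp only; omega)
        exact congrArg (fun y => modeOf (g y)) e
      · have e : (⟨2 * (x.val / 2), by omega⟩ : Fin (2 * k)) = par x := by
          simp only [par]
          rw [dif_neg (by omega)]
          exact Fin.ext (by simp only; omega)
        rw [← hgm x]
        exact congrArg (fun y => modeOf (g y)) e
    exact (Finset.card_le_card this).trans (Finset.card_image_le.trans (by simp))
  have hmem : ∀ x, g x ∈ modeLabels T := by
    intro x
    simp only [modeLabels, Finset.mem_filter, Finset.mem_univ, true_and, T]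
    exact Finset.mem_image_of_mem _ (Finset.mem_univ x)
  -- The `2k` rows are distinct and partners share a mode, so exactly `k` modes occur and their
  -- labels are precisely these rows.
  have hge : 2 * k ≤ 2 * T.card := by
    rw [← card_modeLabels]
    have : Finset.univ.image g ⊆ modeLabels T := by
      intro z hz
      obtain ⟨x, _, rfl⟩ := Finset.mem_image.mp hz
      exact hmem x
    have h2 := Finset.card_le_card this
    rwa [Finset.card_image_of_injective _ hgi, Finset.card_univ, Fintype.card_fin] at h2
  refine ⟨⟨T, by omega⟩, ?_⟩
  rw [abs_minor_eq_abs_det _ _ S hgi hmem]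
  have hdiag : (B.submatrix id π).submatrix g s = Matrix.diagonal (fun x => B (g x) (π (s x))) := by
    ext x y
    rw [Matrix.diagonal_apply]
    split_ifs with h
    · rw [h]; rfl
    · exact hzero _ _ _ (b y) (hne x) (hb y) (fun e => h (hbi e).symm)
  change |((B.submatrix id π).submatrix g s).det| = _
  rw [hdiag, Matrix.det_diagonal, Finset.abs_prod]
  rw [Finset.prod_congr rfl (fun x _ => hflat _ _ _ (hne x) (hb x))]
  simp

/-! ## The randomized family of orthogonal matrices -/

/-- The lower bound on `m` makes blocks large enough to link with all others; the upper bound keeps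
the minors `m^(-k)` large. -/
theorem exists_flat_orthogonal_near {n : ℕ} (hn : 0 < n) :
    ∃ (m : ℕ) (H : Matrix (Fin m) (Fin m) ℝ), 0 < m ∧ 4 * n ≤ m ^ 2 ∧ m ^ 2 ≤ 16 * n ∧
      H * H.transpose = (m : ℝ) • (1 : Matrix (Fin m) (Fin m) ℝ) ∧ ∀ i j, |H i j| = 1 := by
  obtain ⟨s, h1, h2⟩ := exists_nat_pow_near (x := 4 * n) (y := 4) (by omega) (by norm_num)
  have e : ((2 : ℕ) ^ (s + 1)) ^ 2 = 4 ^ (s + 1) := by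
    rw [← pow_mul, mul_comm, pow_mul]; norm_num
  obtain ⟨H, hH, hHabs⟩ := exists_flat_orthogonal (s + 1)
  refine ⟨2 ^ (s + 1), H, by positivity, ?_, ?_, ?_, hHabs⟩
  · rw [e]; exact h2.le
  · rw [e, pow_succ]; omega
  · rw [hH]; push_cast; rfl

theorem submatrix_perm_mem_orthogonalGroup {ι : Type*} [Fintype ι] [DecidableEq ι]
    {B : Matrix ι ι ℝ} (hB : B * B.transpose = 1) (π : Equiv.Perm ι) :
    B.submatrix id π ∈ Matrix.orthogonalGroup ι ℝ := by
  rw [Matrix.mem_orthogonalGroup_iff, Matrix.transpose_submatrix,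
    Matrix.submatrix_mul_equiv, hB]
  rfl

theorem exists_orthogonal_family (k : ℕ) : ∃ n₀ : ℕ, ∀ n : ℕ, n₀ < n →
    ∃ (O : Fin (4 * k + 1) → Matrix (Fin (2 * n)) (Fin (2 * n)) ℝ) (v : ℝ),
      (∀ i, O i ∈ Matrix.orthogonalGroup (Fin (2 * n)) ℝ) ∧ 0 < v ∧ 1 ≤ v ^ 2 * (16 * n) ^ k ∧
      ∀ S : Label n (2 * k), ∃ i, ∃ T : ModeSet n k, v ≤ |minor (O i) T.label S| := by
  -- With `4k + 1` permutations the expected number of unseparated sets is at most `K / √n`, the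
  -- factor `n^(2k)` having cancelled. Hence `n > K²` suffices.
  set K : ℝ := (8 * (k : ℝ) ^ 2) ^ (4 * k + 1) * 4 ^ k with hK
  have hK0 : 0 ≤ K := by positivity
  refine ⟨⌈K ^ 2⌉₊, fun n hn => ?_⟩
  have hn0 : 0 < n := by omega
  have hnR : (0 : ℝ) < n := by exact_mod_cast hn0
  have hKn : K < √n := by
    apply Real.lt_sqrt_of_sq_lt
    exact (Nat.le_ceil _).trans_lt (by exact_mod_cast hn)
  have hs0 : 0 < √(n : ℝ) := Real.sqrt_pos.mpr hnR
  have hs2 : √(n : ℝ) ^ 2 = n := Real.sq_sqrt hnR.le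
  obtain ⟨m, H, hmpos, hm1, hm2, hH, hHabs⟩ := exists_flat_orthogonal_near hn0
  have hmR : (0 : ℝ) < m := by exact_mod_cast hmpos
  have hm2R : (m : ℝ) ^ 2 ≤ 16 * n := by exact_mod_cast hm2
  have hq : 2 * n / m * m ≤ 2 * n := Nat.div_mul_le_self _ _
  have h2q : 2 * (2 * n / m) ≤ m := by
    refine Nat.le_of_mul_le_mul_right ?_ hmpos
    nlinarith
  obtain ⟨B, blk, P, hB, hblk, hP, hmode, hzero, hflat⟩ :=
    exists_block_matrix hmpos hq (Nat.lt_div_mul_add hmpos) h2q hH hHabs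
  have hmle : (m : ℝ) ≤ 4 * √n := by
    refine (sq_le_sq₀ hmR.le (by positivity)).mp ?_
    rw [mul_pow, hs2]; linarith
  set p : ℝ := m * (2 * k) ^ 2 / (2 * n) with hp
  have hp0 : 0 ≤ p := by positivity
  have hple : p ≤ 8 * (k : ℝ) ^ 2 / √n := by
    rw [hp, div_le_div_iff₀ (by positivity) hs0]
    nlinarith [mul_le_mul_of_nonneg_right hmle (show 0 ≤ 4 * (k : ℝ) ^ 2 * √n by positivity)]
  have hcover : p ^ (4 * k + 1) * (2 * n).choose (2 * k) < 1 := by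
    have hc : ((2 * n).choose (2 * k) : ℝ) ≤ (2 * n) ^ (2 * k) := by
      exact_mod_cast Nat.choose_le_pow (2 * n) (2 * k)
    have h1 : p ^ (4 * k + 1) * (2 * n).choose (2 * k) ≤
        (8 * (k : ℝ) ^ 2 / √n) ^ (4 * k + 1) * (2 * n) ^ (2 * k) :=
      mul_le_mul (pow_le_pow_left₀ hp0 hple _) hc (by positivity) (by positivity)
    refine h1.trans_lt ?_
    have h2 : √(n : ℝ) ^ (4 * k + 1) = (n : ℝ) ^ (2 * k) * √n := by
      rw [pow_succ, show 4 * k = 2 * (2 * k) by ring, pow_mul, hs2]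
    have h3 : (2 * (n : ℝ)) ^ (2 * k) = 4 ^ k * (n : ℝ) ^ (2 * k) := by
      rw [mul_pow, pow_mul 2]; norm_num
    rw [div_pow, h2, h3, div_mul_eq_mul_div, div_lt_one (by positivity)]
    calc (8 * (k : ℝ) ^ 2) ^ (4 * k + 1) * (4 ^ k * (n : ℝ) ^ (2 * k))
        = (n : ℝ) ^ (2 * k) * K := by rw [hK]; ring
      _ < (n : ℝ) ^ (2 * k) * √n := mul_lt_mul_of_pos_left hKn (by positivity)
  have : Nonempty (Fin (2 * n)) := ⟨⟨0, by omega⟩⟩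
  obtain ⟨g, hg⟩ := exists_separating_perms blk m (fun c => by
    rw [Nat.card_eq_fintype_card, Fintype.card_subtype]
    exact hblk c) (2 * k) (4 * k + 1) (by
      rw [Fintype.card_fin]
      push_cast
      exact hcover)
  have hw : (√(m : ℝ))⁻¹ ^ 2 = (m : ℝ)⁻¹ := by rw [inv_pow, Real.sq_sqrt hmR.le]
  refine ⟨fun i => B.submatrix id (g i), (√(m : ℝ))⁻¹ ^ (2 * k),
    fun i => submatrix_perm_mem_orthogonalGroup hB _, by positivity, ?_, fun S => ?_⟩
  · rw [pow_mul, hw, ← pow_mul, mul_comm k 2, pow_mul, ← mul_pow]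
    apply one_le_pow₀
    rw [inv_pow, inv_mul_eq_div, one_le_div (by positivity)]
    exact hm2R
  · obtain ⟨i, hi⟩ := hg S.1 S.2
    obtain ⟨T, hT⟩ := exists_large_minor hP hmode hzero hflat (g i) S hi
    exact ⟨i, T, hT.ge⟩

/-! ## Sharpness of the randomized joint measurement -/

theorem div_le_card_mod_fiber {N M : ℕ} (hM : 0 < M) (i : Fin M) :
    N / M ≤ (Finset.univ.filter (fun r : Fin N => r.val % M = i.val)).card := by
  have hlt : ∀ x : Fin (N / M), i.val + M * x.val < N := by
    intro x
    have h1 : M * (x.val + 1) ≤ M * (N / M) := Nat.mul_le_mul_left _ x.2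
    have h2 := Nat.mul_div_le N M
    have := i.2
    rw [Nat.mul_succ] at h1
    omega
  let f : Fin (N / M) → Fin N := fun x => ⟨i.val + M * x.val, hlt x⟩
  have hf : Function.Injective f := by
    intro x y h
    simp only [f, Fin.mk.injEq] at h
    exact Fin.ext (Nat.eq_of_mul_eq_mul_left hM (by omega))
  have hsub : Finset.univ.image f ⊆ Finset.univ.filter (fun r : Fin N => r.val % M = i.val) := by
    intro r hr
    obtain ⟨x, _, rfl⟩ := Finset.mem_image.mp hr
    simp [f, Nat.add_mul_mod_self_left, Nat.mod_eq_of_lt i.2]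
  have := Finset.card_le_card hsub
  rwa [Finset.card_image_of_injective _ hf, Finset.card_univ, Fintype.card_fin] at this

theorem le_sharpness {n N M k : ℕ} (hM : 0 < M) (hMN : M ≤ N)
    (A : Fin M → Matrix (Fin (2 * n)) (Fin (2 * n)) ℝ) {v : ℝ} (hv : 0 < v)
    {R : Fin N → Label n (2 * k) → ModeSet n k}
    (hR : IsOptimalChoice (fun r : Fin N => A ⟨r.val % M, Nat.mod_lt _ hM⟩) R)
    (S : Label n (2 * k)) (hS : ∃ i, ∃ T : ModeSet n k, v ≤ |minor (A i) T.label S|) :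
    v / (2 * M) ≤ sharpness (fun r : Fin N => A ⟨r.val % M, Nat.mod_lt _ hM⟩) R S := by
  obtain ⟨i, T, hT⟩ := hS
  have hN : (0 : ℝ) < N := by exact_mod_cast hM.trans_le hMN
  have hMR : (0 : ℝ) < M := by exact_mod_cast hM
  have hcard : (N : ℝ) ≤ 2 * M *
      (Finset.univ.filter (fun r : Fin N => r.val % M = i.val)).card := by
    have h1 := div_le_card_mod_fiber (N := N) hM i
    -- Every residue class has at least `N / M` members, and rounding down loses at most a factor
    -- `2` because `N ≥ M`.
    have h2 : N ≤ 2 * M * (N / M) := by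
      have h3 := Nat.lt_div_mul_add hM (a := N)
      have h4 : 1 ≤ N / M := (Nat.one_le_div_iff hM).mpr hMN
      nlinarith
    exact_mod_cast h2.trans (Nat.mul_le_mul_left _ h1)
  have hsum : (Finset.univ.filter (fun r : Fin N => r.val % M = i.val)).card * v ≤
      ∑ r : Fin N, |minor (A ⟨r.val % M, Nat.mod_lt _ hM⟩) (R r S).label S| := by
    rw [← nsmul_eq_mul, ← Finset.sum_const]
    refine (Finset.sum_le_sum fun r hr => ?_).trans
      (Finset.sum_le_sum_of_subset_of_nonneg (Finset.subset_univ _) fun _ _ _ => abs_nonneg _)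
    have hri : (⟨r.val % M, Nat.mod_lt _ hM⟩ : Fin M) = i := Fin.ext (Finset.mem_filter.mp hr).2
    have := hR r S T
    simp only [hri] at this ⊢
    exact hT.trans this
  unfold sharpness
  rw [inv_mul_eq_div, div_le_div_iff₀ (by positivity) hN]
  nlinarith

/-- With single-shot bound `b = 2M / v` the exponent is `L ε² v² / (64 M²)`, and `v⁻² ≤ (16n)^k`.
The `2` in `2 n^k` turns `64` into `32`. -/
theorem sample_bound {k M n L : ℕ} {v ε δ c : ℝ} (hM : 0 < M) (hv : 0 < v)
    (hvn : 1 ≤ v ^ 2 * (16 * n) ^ k) (hε : 0 < ε) (hδ : 0 < δ) (hδ1 : δ < 1) (hc : 1 ≤ c)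
    (hL : 32 * (M : ℝ) ^ 2 * 16 ^ k * (2 * (n : ℝ) ^ k / ε ^ 2 * Real.log (2 * c / δ)) ≤ L) :
    2 * c * Real.exp (-(L * ε ^ 2 / (4 * (2 * (2 * M / v)) ^ 2))) ≤ δ := by
  have hMR : (0 : ℝ) < M := by exact_mod_cast hM
  have h1 : 1 ≤ 2 * c / δ := by rw [one_le_div hδ]; linarith
  have hlog : 0 ≤ Real.log (2 * c / δ) := Real.log_nonneg h1
  have key : Real.log (2 * c / δ) ≤ L * ε ^ 2 / (4 * (2 * (2 * M / v)) ^ 2) := by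
    rw [le_div_iff₀ (by positivity)]
    have e1 : 32 * (M : ℝ) ^ 2 * 16 ^ k * (2 * (n : ℝ) ^ k / ε ^ 2 * Real.log (2 * c / δ)) * ε ^ 2 =
        64 * (M : ℝ) ^ 2 * (16 * n) ^ k * Real.log (2 * c / δ) := by
      rw [mul_pow]; field_simp; ring
    have e2 : Real.log (2 * c / δ) * (4 * (2 * (2 * M / v)) ^ 2) =
        64 * (M : ℝ) ^ 2 * (1 / v ^ 2) * Real.log (2 * c / δ) := by
      field_simp; ring
    have h3 : 1 / v ^ 2 ≤ (16 * (n : ℝ)) ^ k := by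
      rw [div_le_iff₀ (by positivity)]; linarith
    rw [e2]
    refine le_trans ?_ (mul_le_mul_of_nonneg_right hL (sq_nonneg ε))
    rw [e1]
    gcongr
  have h4 : Real.exp (-(L * ε ^ 2 / (4 * (2 * (2 * M / v)) ^ 2))) ≤ (2 * c / δ)⁻¹ := by
    rw [← Real.exp_log (show 0 < 2 * c / δ by positivity), ← Real.exp_neg]
    simpa using key
  calc 2 * c * Real.exp (-(L * ε ^ 2 / (4 * (2 * (2 * M / v)) ^ 2)))
      ≤ 2 * c * (2 * c / δ)⁻¹ := mul_le_mul_of_nonneg_left h4 (by positivity)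
    _ = δ := by field_simp

/-- A lower bound `h` on all sharpnesses turns into a simultaneous confidence interval. -/
theorem iidProb_estimator {n N k : ℕ} (hn : 0 < n)
    {O : Fin N → Matrix (Fin (2 * n)) (Fin (2 * n)) ℝ}
    (hO : ∀ r, O r ∈ Matrix.orthogonalGroup (Fin (2 * n)) ℝ) (hpovm : IsPOVM (jointMeasurement O))
    (R : Fin N → Label n (2 * k) → ModeSet n k) {b : ℝ} (hb : 0 < b)
    (hsharp : ∀ S, b⁻¹ ≤ sharpness O R S) {ε : ℝ} (hε : 0 < ε) (L : ℕ) {ρ : FockOp n}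
    (hρ : IsState ρ) :
    1 - 2 * Fintype.card (Label n (2 * k)) * Real.exp (-(L * ε ^ 2 / (4 * (2 * b) ^ 2))) ≤
      iidProb (shotProb k O ρ) L {ω | ∀ S : Label n (2 * k),
        |expectation S.1 ρ - estimator O R S ω| < ε} := by
  have hp := shotProb_nonneg (k := k) hpovm hρ
  have hsum := sum_shotProb (k := k) hpovm hρ
  have hpos : ∀ S, 0 < sharpness O R S := fun S => (inv_pos.mpr hb).trans_le (hsharp S)
  have hY : ∀ S ω, |(sharpness O R S)⁻¹ * outcomeSign O R S ω| ≤ b := by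
    intro S ω
    rw [abs_mul, abs_outcomeSign, mul_one, abs_of_pos (inv_pos.mpr (hpos S))]
    exact inv_le_of_inv_le₀ hb (hsharp S)
  have hmean : ∀ S, ∑ ω, shotProb k O ρ ω * ((sharpness O R S)⁻¹ * outcomeSign O R S ω) =
      expectation S.1 ρ := by
    intro S
    have := sum_shotProb_outcomeSign hn hO ρ R S
    rw [← inv_mul_cancel_left₀ (hpos S).ne' (expectation S.1 ρ), ← this, Finset.mul_sum]
    exact Finset.sum_congr rfl fun ω _ => by ring
  -- As a mean of values bounded by `b`; centering therefore costs the factor `2` in `B := 2 * b`.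
  have hE : ∀ S : Label n (2 * k), |expectation S.1 ρ| ≤ b := by
    intro S
    rw [← hmean S]
    refine (Finset.abs_sum_le_sum_abs _ _).trans ?_
    calc ∑ ω, |shotProb k O ρ ω * ((sharpness O R S)⁻¹ * outcomeSign O R S ω)|
        ≤ ∑ ω, shotProb k O ρ ω * b := by
          refine Finset.sum_le_sum fun ω _ => ?_
          rw [abs_mul, abs_of_nonneg (hp ω)]
          exact mul_le_mul_of_nonneg_left (hY S ω) (hp ω)
      _ = b := by rw [← Finset.sum_mul, hsum, one_mul]
  have key := iidProb_forall_abs_sum_lt hp hsum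
    (Z := fun (S : Label n (2 * k)) ω =>
      (sharpness O R S)⁻¹ * outcomeSign O R S ω - expectation S.1 ρ)
    (fun S => by
      simp only [mul_sub, Finset.sum_sub_distrib, ← Finset.sum_mul]
      rw [hmean, hsum]; ring)
    (B := 2 * b) (by positivity)
    (fun S ω => by
      refine (abs_sub _ _).trans ?_
      linarith [hY S ω, hE S]) hε L
  refine key.trans (iidProb_mono hp fun ω hω S => ?_)
  have h1 := hω S
  -- For `L = 0` the strict inequality in `h1` would read `0 < 0`.
  have hL : (0 : ℝ) < L := by
    by_contra hc
    have : (L : ℝ) * ε ≤ 0 := mul_nonpos_of_nonpos_of_nonneg (not_lt.mp hc) hε.le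
    linarith [abs_nonneg (∑ j, ((sharpness O R S)⁻¹ * outcomeSign O R S (ω j) - expectation S.1 ρ))]
  have e : expectation S.1 ρ - estimator O R S ω =
      - ((L : ℝ)⁻¹ * ∑ j, ((sharpness O R S)⁻¹ * outcomeSign O R S (ω j) - expectation S.1 ρ)) := by
    rw [estimator, Finset.sum_sub_distrib, Finset.sum_const, Finset.card_univ, Fintype.card_fin,
      nsmul_eq_mul]
    field_simp
    ring
  rw [e, abs_neg, abs_mul, abs_of_pos (inv_pos.mpr hL), inv_mul_lt_iff₀ hL]
  exact h1

end FermionicJM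

theorem proposition3 (k : ℕ) :
    ∃ C : ℝ, 0 < C ∧ ∃ n₀ : ℕ, ∀ n : ℕ, n₀ < n → ∀ N : ℕ, 4 * k < N →
      ∃ O : Fin N → Matrix (Fin (2 * n)) (Fin (2 * n)) ℝ,
        (∀ r, O r ∈ Matrix.orthogonalGroup (Fin (2 * n)) ℝ) ∧
        FermionicJM.IsPOVM (FermionicJM.jointMeasurement O) ∧
        ∀ R : Fin N → FermionicJM.Label n (2 * k) → FermionicJM.ModeSet n k,
          FermionicJM.IsOptimalChoice O R →
          ∀ ε δ : ℝ, 0 < ε → 0 < δ → δ < 1 →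
          ∀ L : ℕ,
            C * (2 * (n : ℝ) ^ k / ε ^ 2 *
              Real.log (2 * (Fintype.card (FermionicJM.Label n (2 * k)) : ℝ) / δ)) ≤ (L : ℝ) →
          ∀ ρ : FermionicJM.FockOp n, FermionicJM.IsState ρ →
            1 - δ ≤ FermionicJM.iidProb (FermionicJM.shotProb k O ρ) L
              {ω | ∀ S : FermionicJM.Label n (2 * k),
                |FermionicJM.expectation S.1 ρ - FermionicJM.estimator O R S ω| < ε} := by
  obtain ⟨n₀, h₀⟩ := FermionicJM.exists_orthogonal_family k
  have hM : 0 < 4 * k + 1 := Nat.succ_pos _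
  refine ⟨32 * ((4 * k + 1 : ℕ) : ℝ) ^ 2 * 16 ^ k, by positivity, n₀, fun n hn N hN => ?_⟩
  obtain ⟨A, v, hA, hv, hvn, hS⟩ := h₀ n hn
  have hn0 : 0 < n := by omega
  have hO : ∀ r : Fin N, A ⟨r.val % (4 * k + 1), Nat.mod_lt _ hM⟩ ∈
      Matrix.orthogonalGroup (Fin (2 * n)) ℝ := fun r => hA _
  have hpovm := FermionicJM.jointMeasurement_isPOVM hn0 (by omega) hO
  -- The `4k + 1` matrices are repeated cyclically to make a family of size `N`.
  refine ⟨fun r => A ⟨r.val % (4 * k + 1), Nat.mod_lt _ hM⟩, hO, hpovm, ?_⟩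
  intro R hR ε δ hε hδ hδ1 L hL ρ hρ
  have hb : 0 < 2 * ((4 * k + 1 : ℕ) : ℝ) / v := by positivity
  have key := FermionicJM.iidProb_estimator hn0 hO hpovm R hb (fun S => by
    rw [inv_div]
    exact FermionicJM.le_sharpness hM (by omega) A hv hR S (hS S)) hε L hρ
  refine le_trans ?_ key
  -- Without labels, that is for `k > n`, the failure term is zero; `sample_bound` needs at least
  -- one.
  rcases Nat.eq_zero_or_pos (Fintype.card (FermionicJM.Label n (2 * k))) with h0 | h0
  · rw [h0]; simp [hδ.le]
  · have := FermionicJM.sample_bound hM hv hvn hε hδ hδ1 (by exact_mod_cast h0) hL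
    linarith
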